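/- Let $m,d\ge 2$ and $n\ge 1$ be integers, let $q_0,\dots,q_{m-1}\in\mathbb C^\times$, and put $t_s=\prod_{0\le s'\le s}q_{s'}$ and $t=t_{m-1}=\prod_s q_s$. Assume that $t_s^{-1}t_{s'}\ne t^k$ for all $0\le s\le s'\le m-1$ and $k\in\mathbb Z$, with $k\neq 0$ if $s=s'$. Indices $s$ are read in $I=\mathbb Z/m\mathbb Z=\{0,\dots,m-1\}$. *The cyclic space.* Let $R$ be the affine variety of all $(X_s,Y_s,V_\alpha,W_\alpha)_{s\in I,\,1\le\alpha\le d}$ with $X_s,Y_s\in\mathrm{Mat}_{n\times n}(\mathbb C)$, $V_\alpha\in\mathrm{Mat}_{1\times n}(\mathbb C)$, $W_\alpha\in\mathrm{Mat}_{n\times 1}(\mathbb C)$ such that all $\mathrm{Id}+X_sY_s$, $\mathrm{Id}+Y_sX_s$, $\mathrm{Id}+W_\alpha V_\alpha$, $1+V_\alpha W_\alpha$ are invertible and $$(\mathrm{Id}+X_0Y_0)(\mathrm{Id}+Y_{m-1}X_{m-1})^{-1}=q_0(\mathrm{Id}+W_dV_d)\cdots(\mathrm{Id}+W_1V_1),$$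 $$(\mathrm{Id}+X_sY_s)(\mathrm{Id}+Y_{s-1}X_{s-1})^{-1}=q_s\mathrm{Id}\quad(s\ne0),\qquad \prod_{\alpha}(1+V_\alpha W_\alpha)=t^{-n}.$$ The group $\prod_{s\in I}\mathrm{GL}_n(\mathbb C)$ acts on $R$ by $g\cdot(X_s,Y_s,V_\alpha,W_\alpha)=(g_sX_sg_{s+1}^{-1},\,g_{s+1}Y_sg_s^{-1},\,V_\alpha g_0^{-1},\,g_0W_\alpha)$. Let $\mathcal C_{n,q,d}(m)$ be the affine GIT quotient $R/\!/\prod_s\mathrm{GL}_n(\mathbb C)$ (the spectrum of the ring of invariant regular functions), and let $\mathcal C^\circ_{n,q,d}(m)\subset\mathcal C_{n,q,d}(m)$ be the open subset on which all $X_s$ are invertible, i.e. on which $\prod_s\det X_s\neq0$. Where the $X_s$ are invertible put $Z_s=Y_s+X_s^{-1}$, and let $\mathbf A^{(m)}\in\mathrm{Mat}_{n\times d}$ be the matrix with columns $W_\alpha$ and $\mathbf C^{(m)}\in\mathrm{Mat}_{d\times n}$ the matrix with rows $t^{-1}V_\alpha(\mathrm{Id}+W_{\alpha-1}V_{\alpha-1})\cdots(\mathrm{Id}+W_1V_1)Z_{m-1}$.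 *The spin Ruijsenaars–Schneider space.* Let $T$ be the affine variety of all $(A,B,V'_\alpha,W'_\alpha)_{1\le\alpha\le d}$ with $A,B\in\mathrm{GL}_n(\mathbb C)$, $V'_\alpha\in\mathrm{Mat}_{1\times n}(\mathbb C)$, $W'_\alpha\in\mathrm{Mat}_{n\times 1}(\mathbb C)$, all $\mathrm{Id}+W'_\alpha V'_\alpha$ invertible, and $$ABA^{-1}B^{-1}(\mathrm{Id}+W'_1V'_1)^{-1}\cdots(\mathrm{Id}+W'_dV'_d)^{-1}=t\,\mathrm{Id}.$$ The group $\mathrm{GL}_n(\mathbb C)$ acts on it by $g\cdot(A,B,V'_\alpha,W'_\alpha)=(gAg^{-1},gBg^{-1},V'_\alpha g^{-1},gW'_\alpha)$; let $\mathcal C^\circ_{n,t,d}=T/\!/\mathrm{GL}_n(\mathbb C)$. Let $\mathbf A$ be the matrix with columns $W'_\alpha$ and $\mathbf C$ the matrix with rows $V'_\alpha(\mathrm{Id}+W'_{\alpha-1}V'_{\alpha-1})\cdots(\mathrm{Id}+W'_1V'_1)B$. **Proposition.** For every $(A,B,V'_\alpha,W'_\alpha)\in T$ there is exactly one point $(X_s,Y_s,V_\alpha,W_\alpha)\in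 R$ with $$X_s=\mathrm{Id},\quad Z_s=t_sB\quad(0\le s\le m-2),\qquad X_{m-1}=A,\quad Z_{m-1}=tA^{-1}B,\qquad \mathbf A^{(m)}=A^{-1}\mathbf A,\quad \mathbf C^{(m)}=\mathbf C.$$ The resulting map $T\to R$ induces a bijection from the $\mathrm{GL}_n(\mathbb C)$-orbits in $T$ to the $\prod_s\mathrm{GL}_n(\mathbb C)$-orbits in $R$ consisting of points with all $X_s$ invertible, and there is an isomorphism of varieties over $\mathbb C$ $$\psi:\ \mathcal C^\circ_{n,t,d}\ \xrightarrow{\ \sim\ }\ \mathcal C^\circ_{n,q,d}(m)$$ which sends the point defined by $(A,B,V'_\alpha,W'_\alpha)$ to the point defined by its image in $R$. -/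

import Mathlib

open AlgebraicGeometry CategoryTheory Matrix

namespace SpinRS

/-! ### Affine GIT quotients of affine varieties over `ℂ`

A complex affine variety is given by its set `P` of points and its ring `O` of regular functions
(a `ℂ`-algebra of functions on `P`). If a group acts on it, the affine GIT quotient is the spectrum
of the ring of invariant regular functions. -/

section GIT

variable {P : Type} (G : Type) [Group G] [MulAction G P] (O : Subalgebra ℂ (P → ℂ))

/-- The ring of `G`-invariant regular functions. -/
def invariants : Subalgebra ℂ (P → ℂ) where
  carrier := {f | f ∈ O ∧ ∀ (g : G) (x : P), f (g • x) = f x}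
  mul_mem' ha hb := ⟨O.mul_mem ha.1 hb.1, fun g x => by simp [ha.2 g x, hb.2 g x]⟩
  add_mem' ha hb := ⟨O.add_mem ha.1 hb.1, fun g x => by simp [ha.2 g x, hb.2 g x]⟩
  algebraMap_mem' r := ⟨O.algebraMap_mem r, fun _ _ => rfl⟩

/-- The affine GIT quotient `P // G`. -/
noncomputable def gitQuotient : Scheme := Spec (CommRingCat.of (invariants G O))

/-- The structure morphism `P // G ⟶ Spec ℂ`. -/
noncomputable def gitQuotientStr : gitQuotient G O ⟶ Spec (CommRingCat.of ℂ) :=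
  Spec.map (CommRingCat.ofHom (algebraMap ℂ (invariants G O)))

/-- The `ℂ`-point of `P // G` defined by (the orbit of) a point `x` of `P`: it corresponds to
evaluation of invariant functions at `x`. -/
noncomputable def gitQuotientPoint (x : P) : Spec (CommRingCat.of ℂ) ⟶ gitQuotient G O :=
  Spec.map (CommRingCat.ofHom
    ((Pi.evalRingHom (fun _ : P => ℂ) x).comp (invariants G O).val.toRingHom))

end GIT

/-! ### Matrix notation -/

/-- The matrix `Id_n + W V` for a column `W` and a row `V`. -/
def rankOne {n : ℕ} (W V : Fin n → ℂ) : Matrix (Fin n) (Fin n) ℂ := 1 + vecMulVec W V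

/-- The product `(Id + W_{k-1} V_{k-1}) ⋯ (Id + W_1 V_1)(Id + W_0 V_0)` of the first `k` factors,
in decreasing order of the indices (the indices run through `0, …, d - 1`). -/
def decProd {n d : ℕ} (W V : Fin d → Fin n → ℂ) (k : ℕ) : Matrix (Fin n) (Fin n) ℂ :=
  ((List.ofFn fun α => rankOne (W α) (V α)).take k).reverse.prod

/-- The matrix in `Mat_{n × d}` whose columns are the `W_α`. -/
def spinA {n d : ℕ} (W : Fin d → Fin n → ℂ) : Matrix (Fin n) (Fin d) ℂ :=
  Matrix.of fun i α => W α i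

/-- The matrix in `Mat_{d × n}` whose `α`-th row is
`V_α (Id + W_{α-1} V_{α-1}) ⋯ (Id + W_0 V_0) Z`. -/
def spinC {n d : ℕ} (W V : Fin d → Fin n → ℂ) (Z : Matrix (Fin n) (Fin n) ℂ) :
    Matrix (Fin d) (Fin n) ℂ :=
  Matrix.of fun α j => (V α ᵥ* (decProd W V α * Z)) j

/-! Behaviour of these expressions under a change of basis. -/

section Conj

variable {n d : ℕ}

theorem one_add_conj (g h : GL (Fin n) ℂ) (X Y : Matrix (Fin n) (Fin n) ℂ) :
    1 + (g.1 * X * h⁻¹.1) * (h.1 * Y * g⁻¹.1) = g.1 * (1 + X * Y) * g⁻¹.1 := by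
  have h1 : h⁻¹.1 * h.1 = 1 := h.inv_mul
  have h2 : g.1 * g⁻¹.1 = 1 := g.mul_inv
  calc 1 + (g.1 * X * h⁻¹.1) * (h.1 * Y * g⁻¹.1)
      = 1 + g.1 * X * (h⁻¹.1 * h.1) * Y * g⁻¹.1 := by simp only [Matrix.mul_assoc]
    _ = g.1 * (1 + X * Y) * g⁻¹.1 := by
        rw [h1, Matrix.mul_one, Matrix.mul_add, Matrix.add_mul, Matrix.mul_one, h2]
        simp only [Matrix.mul_assoc]

theorem conj_mul_conj (g : GL (Fin n) ℂ) (M N : Matrix (Fin n) (Fin n) ℂ) :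
    (g.1 * M * g⁻¹.1) * (g.1 * N * g⁻¹.1) = g.1 * (M * N) * g⁻¹.1 := by
  have h1 : g⁻¹.1 * g.1 = 1 := g.inv_mul
  calc (g.1 * M * g⁻¹.1) * (g.1 * N * g⁻¹.1)
      = g.1 * M * (g⁻¹.1 * g.1) * N * g⁻¹.1 := by simp only [Matrix.mul_assoc]
    _ = _ := by rw [h1]; simp only [Matrix.mul_assoc, Matrix.one_mul]

theorem conj_inv (g : GL (Fin n) ℂ) (M : Matrix (Fin n) (Fin n) ℂ) :
    (g.1 * M * g⁻¹.1)⁻¹ = g.1 * M⁻¹ * g⁻¹.1 := by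
  have h1 : (g.1)⁻¹ = g⁻¹.1 := (Matrix.coe_units_inv g).symm
  have h2 : (g⁻¹.1)⁻¹ = g.1 := by
    rw [← Matrix.coe_units_inv]; simp
  rw [Matrix.mul_inv_rev, Matrix.mul_inv_rev, h1, h2, Matrix.mul_assoc]

theorem conj_smul_one (g : GL (Fin n) ℂ) (c : ℂ) :
    g.1 * (c • (1 : Matrix (Fin n) (Fin n) ℂ)) * g⁻¹.1 = c • 1 := by
  have h2 : g.1 * g⁻¹.1 = 1 := g.mul_inv
  simp only [Matrix.mul_smul, Matrix.smul_mul, Matrix.mul_one, h2]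

theorem conj_det (g : GL (Fin n) ℂ) (M : Matrix (Fin n) (Fin n) ℂ) :
    (g.1 * M * g⁻¹.1).det = M.det := by
  rw [Matrix.det_mul_comm, ← Matrix.mul_assoc, show g⁻¹.1 * g.1 = 1 from g.inv_mul, Matrix.one_mul]

theorem rankOne_conj (g : GL (Fin n) ℂ) (W V : Fin n → ℂ) :
    rankOne (g.1 *ᵥ W) (V ᵥ* g⁻¹.1) = g.1 * rankOne W V * g⁻¹.1 := by
  have h2 : g.1 * g⁻¹.1 = 1 := g.mul_inv
  have h3 : vecMulVec (g.1 *ᵥ W) (V ᵥ* g⁻¹.1) = g.1 * vecMulVec W V * g⁻¹.1 := by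
    rw [Matrix.mul_vecMulVec, Matrix.vecMulVec_mul]
  rw [rankOne, rankOne, h3, Matrix.mul_add, Matrix.add_mul, Matrix.mul_one, h2]

theorem dotProduct_conj (g : GL (Fin n) ℂ) (W V : Fin n → ℂ) :
    (V ᵥ* g⁻¹.1) ⬝ᵥ (g.1 *ᵥ W) = V ⬝ᵥ W := by
  rw [Matrix.dotProduct_mulVec, Matrix.vecMul_vecMul, show g⁻¹.1 * g.1 = 1 from g.inv_mul,
    Matrix.vecMul_one]

theorem list_prod_conj (g : GL (Fin n) ℂ) (l : List (Matrix (Fin n) (Fin n) ℂ)) :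
    (l.map fun M => g.1 * M * g⁻¹.1).prod = g.1 * l.prod * g⁻¹.1 := by
  induction l with
  | nil => simp only [List.map_nil, List.prod_nil, Matrix.mul_one]; exact g.mul_inv.symm
  | cons a l ih => rw [List.map_cons, List.prod_cons, List.prod_cons, ih, conj_mul_conj]

theorem decProd_conj (g : GL (Fin n) ℂ) (W V : Fin d → Fin n → ℂ) (k : ℕ) :
    decProd (fun α => g.1 *ᵥ W α) (fun α => V α ᵥ* g⁻¹.1) k = g.1 * decProd W V k * g⁻¹.1 := by
  rw [decProd, decProd, ← list_prod_conj, List.map_reverse, List.map_take, List.map_ofFn]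
  simp only [rankOne_conj]
  rfl

end Conj

/-! ### The spin Ruijsenaars–Schneider space -/

/-- Quadruples `(A, B, V', W')`: two square matrices, rows `V'_α` and columns `W'_α`. -/
@[ext]
structure TadpoleData (n d : ℕ) where
  A : Matrix (Fin n) (Fin n) ℂ
  B : Matrix (Fin n) (Fin n) ℂ
  V : Fin d → Fin n → ℂ
  W : Fin d → Fin n → ℂ

/-- `g • (A, B, V', W') = (g A g⁻¹, g B g⁻¹, V' g⁻¹, g W')`. -/
instance (n d : ℕ) : MulAction (GL (Fin n) ℂ) (TadpoleData n d) where
  smul g τ := ⟨g.1 * τ.A * g⁻¹.1, g.1 * τ.B * g⁻¹.1, fun α => τ.V α ᵥ* g⁻¹.1,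
    fun α => g.1 *ᵥ τ.W α⟩
  one_smul τ := by
    ext1
    · change (1 : GL (Fin n) ℂ).1 * τ.A * (1 : GL (Fin n) ℂ)⁻¹.1 = τ.A; simp
    · change (1 : GL (Fin n) ℂ).1 * τ.B * (1 : GL (Fin n) ℂ)⁻¹.1 = τ.B; simp
    · change (fun α => τ.V α ᵥ* (1 : GL (Fin n) ℂ)⁻¹.1) = τ.V; simp
    · change (fun α => (1 : GL (Fin n) ℂ).1 *ᵥ τ.W α) = τ.W; simp
  mul_smul g h τ := by
    ext1
    · change (g * h).1 * τ.A * (g * h)⁻¹.1 = g.1 * (h.1 * τ.A * h⁻¹.1) * g⁻¹.1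
      rw [_root_.mul_inv_rev, Units.val_mul, Units.val_mul]; simp only [Matrix.mul_assoc]
    · change (g * h).1 * τ.B * (g * h)⁻¹.1 = g.1 * (h.1 * τ.B * h⁻¹.1) * g⁻¹.1
      rw [_root_.mul_inv_rev, Units.val_mul, Units.val_mul]; simp only [Matrix.mul_assoc]
    · change (fun α => τ.V α ᵥ* (g * h)⁻¹.1) = fun α => (τ.V α ᵥ* h⁻¹.1) ᵥ* g⁻¹.1
      rw [_root_.mul_inv_rev, Units.val_mul]; simp only [Matrix.vecMul_vecMul]
    · change (fun α => (g * h).1 *ᵥ τ.W α) = fun α => g.1 *ᵥ (h.1 *ᵥ τ.W α)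
      rw [Units.val_mul]; simp only [Matrix.mulVec_mulVec]

/-- `A, B` and all `Id + W'_α V'_α` are invertible and
`A B A⁻¹ B⁻¹ (Id + W'_1 V'_1)⁻¹ ⋯ (Id + W'_d V'_d)⁻¹ = t Id`. -/
structure IsTadpole {n d : ℕ} (t : ℂˣ) (τ : TadpoleData n d) : Prop where
  det_A : τ.A.det ≠ 0
  det_B : τ.B.det ≠ 0
  det_WV : ∀ α, (rankOne (τ.W α) (τ.V α)).det ≠ 0
  momentMap : τ.A * τ.B * τ.A⁻¹ * τ.B⁻¹ * (List.ofFn fun α => (rankOne (τ.W α) (τ.V α))⁻¹).prod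
    = (t : ℂ) • (1 : Matrix (Fin n) (Fin n) ℂ)

/-- The points `(A, B, V', W')` satisfying the moment map equation. -/
def TadpoleRep (n d : ℕ) (t : ℂˣ) : Type := {τ : TadpoleData n d // IsTadpole t τ}

theorem IsTadpole.smul {n d : ℕ} {t : ℂˣ} {τ : TadpoleData n d} (h : IsTadpole t τ)
    (g : GL (Fin n) ℂ) : IsTadpole t (g • τ) where
  det_A := by
    change (g.1 * τ.A * g⁻¹.1).det ≠ 0
    rw [conj_det]; exact h.det_A
  det_B := by
    change (g.1 * τ.B * g⁻¹.1).det ≠ 0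
    rw [conj_det]; exact h.det_B
  det_WV α := by
    change (rankOne (g.1 *ᵥ τ.W α) (τ.V α ᵥ* g⁻¹.1)).det ≠ 0
    rw [rankOne_conj, conj_det]; exact h.det_WV α
  momentMap := by
    change (g.1 * τ.A * g⁻¹.1) * (g.1 * τ.B * g⁻¹.1) * (g.1 * τ.A * g⁻¹.1)⁻¹ *
      (g.1 * τ.B * g⁻¹.1)⁻¹ *
      (List.ofFn fun α => (rankOne (g.1 *ᵥ τ.W α) (τ.V α ᵥ* g⁻¹.1))⁻¹).prod = _
    have hl : (List.ofFn fun α => (rankOne (g.1 *ᵥ τ.W α) (τ.V α ᵥ* g⁻¹.1))⁻¹)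
        = (List.ofFn fun α => (rankOne (τ.W α) (τ.V α))⁻¹).map fun M => g.1 * M * g⁻¹.1 := by
      rw [List.map_ofFn]; simp only [rankOne_conj, conj_inv]; rfl
    rw [hl, list_prod_conj, conj_inv, conj_inv, conj_mul_conj, conj_mul_conj, conj_mul_conj,
      conj_mul_conj, h.momentMap, conj_smul_one]

instance (n d : ℕ) (t : ℂˣ) : MulAction (GL (Fin n) ℂ) (TadpoleRep n d t) where
  smul g τ := ⟨g • τ.1, τ.2.smul g⟩
  one_smul τ := Subtype.ext (one_smul _ τ.1)
  mul_smul g h τ := Subtype.ext (mul_smul g h τ.1)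

/-- The regular functions on the affine variety `TadpoleRep n d t`: the polynomials in the entries
of the matrices and in the inverses of the determinants of `A`, `B` and `Id + W'_α V'_α`. -/
def tadpoleFunctions (n d : ℕ) (t : ℂˣ) : Subalgebra ℂ (TadpoleRep n d t → ℂ) :=
  Algebra.adjoin ℂ
    ({f | ∃ i j, f = fun τ => τ.1.A i j} ∪ {f | ∃ i j, f = fun τ => τ.1.B i j} ∪
     {f | ∃ α i, f = fun τ => τ.1.V α i} ∪ {f | ∃ α i, f = fun τ => τ.1.W α i} ∪
     {fun τ => τ.1.A.det⁻¹} ∪ {fun τ => τ.1.B.det⁻¹} ∪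
     {f | ∃ α, f = fun τ => (rankOne (τ.1.W α) (τ.1.V α)).det⁻¹})

/-- The spin Ruijsenaars–Schneider space `C°_{n,t,d}`. -/
noncomputable def tadpoleSpace (n d : ℕ) (t : ℂˣ) : Scheme :=
  gitQuotient (GL (Fin n) ℂ) (tadpoleFunctions n d t)

/-- Its structure morphism. -/
noncomputable def tadpoleStr (n d : ℕ) (t : ℂˣ) : tadpoleSpace n d t ⟶ Spec (CommRingCat.of ℂ) :=
  gitQuotientStr (GL (Fin n) ℂ) (tadpoleFunctions n d t)

/-- The point of the spin Ruijsenaars–Schneider space defined by `(A, B, V', W')`. -/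
noncomputable def tadpolePoint {n d : ℕ} {t : ℂˣ} (τ : TadpoleRep n d t) :
    Spec (CommRingCat.of ℂ) ⟶ tadpoleSpace n d t :=
  gitQuotientPoint (GL (Fin n) ℂ) (tadpoleFunctions n d t) τ

/-! ### The multiplicative quiver variety of the spin cyclic quiver

The vertices of the cycle are `Fin m`, with cyclic addition: `s + 1` is the vertex following `s`,
and `-1` is the vertex `m - 1`. -/

/-- `t_s = ∏_{0 ≤ s' ≤ s} q_{s'}`. -/
def partialT {m : ℕ} (q : Fin m → ℂˣ) (s : Fin m) : ℂˣ := ∏ s' ∈ Finset.Iic s, q s'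

/-- `t = ∏_s q_s`. -/
def totalT {m : ℕ} (q : Fin m → ℂˣ) : ℂˣ := ∏ s, q s

/-- The regularity condition on the parameters: `t_s⁻¹ t_{s'} ≠ t ^ k` for all
`0 ≤ s ≤ s' ≤ m - 1` and all integers `k`, with `k ≠ 0` if `s = s'`. -/
def RegularParameters {m : ℕ} (q : Fin m → ℂˣ) : Prop :=
  ∀ (s s' : Fin m) (k : ℤ), s ≤ s' → (s = s' → k ≠ 0) →
    (partialT q s)⁻¹ * partialT q s' ≠ totalT q ^ k

/-- Collections `(X_s, Y_s, V_α, W_α)` of matrices. -/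
@[ext]
structure CyclicData (m n d : ℕ) where
  X : Fin m → Matrix (Fin n) (Fin n) ℂ
  Y : Fin m → Matrix (Fin n) (Fin n) ℂ
  V : Fin d → Fin n → ℂ
  W : Fin d → Fin n → ℂ

section Cyclic

variable {m n d : ℕ} [NeZero m]

/-- `g • (X_s, Y_s, V_α, W_α) = (g_s X_s g_{s+1}⁻¹, g_{s+1} Y_s g_s⁻¹, V_α g_0⁻¹, g_0 W_α)`. -/
instance : MulAction (Fin m → GL (Fin n) ℂ) (CyclicData m n d) where
  smul g p := ⟨fun s => (g s).1 * p.X s * (g (s + 1))⁻¹.1,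
    fun s => (g (s + 1)).1 * p.Y s * (g s)⁻¹.1,
    fun α => p.V α ᵥ* (g 0)⁻¹.1, fun α => (g 0).1 *ᵥ p.W α⟩
  one_smul p := by
    ext1
    · change (fun s => (1 : GL (Fin n) ℂ).1 * p.X s * (1 : GL (Fin n) ℂ)⁻¹.1) = p.X; simp
    · change (fun s => (1 : GL (Fin n) ℂ).1 * p.Y s * (1 : GL (Fin n) ℂ)⁻¹.1) = p.Y; simp
    · change (fun α => p.V α ᵥ* (1 : GL (Fin n) ℂ)⁻¹.1) = p.V; simp
    · change (fun α => (1 : GL (Fin n) ℂ).1 *ᵥ p.W α) = p.W; simp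
  mul_smul g h p := by
    ext1
    · change (fun s => (g s * h s).1 * p.X s * (g (s + 1) * h (s + 1))⁻¹.1) =
        fun s => (g s).1 * ((h s).1 * p.X s * (h (s + 1))⁻¹.1) * (g (s + 1))⁻¹.1
      funext s
      rw [_root_.mul_inv_rev, Units.val_mul, Units.val_mul]; simp only [Matrix.mul_assoc]
    · change (fun s => (g (s + 1) * h (s + 1)).1 * p.Y s * (g s * h s)⁻¹.1) =
        fun s => (g (s + 1)).1 * ((h (s + 1)).1 * p.Y s * (h s)⁻¹.1) * (g s)⁻¹.1
      funext s
      rw [_root_.mul_inv_rev, Units.val_mul, Units.val_mul]; simp only [Matrix.mul_assoc]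
    · change (fun α => p.V α ᵥ* (g 0 * h 0)⁻¹.1) = fun α => (p.V α ᵥ* (h 0)⁻¹.1) ᵥ* (g 0)⁻¹.1
      rw [_root_.mul_inv_rev, Units.val_mul]; simp only [Matrix.vecMul_vecMul]
    · change (fun α => (g 0 * h 0).1 *ᵥ p.W α) = fun α => (g 0).1 *ᵥ ((h 0).1 *ᵥ p.W α)
      rw [Units.val_mul]; simp only [Matrix.mulVec_mulVec]

/-- The defining equations of a representation of dimension `(1, n, …, n)` of the multiplicative
preprojective algebra of the spin cyclic quiver, with parameters `q_∞ = t⁻ⁿ` and `q_s`. -/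
structure IsCyclic (q : Fin m → ℂˣ) (p : CyclicData m n d) : Prop where
  det_XY : ∀ s, (1 + p.X s * p.Y s).det ≠ 0
  det_YX : ∀ s, (1 + p.Y s * p.X s).det ≠ 0
  det_WV : ∀ α, (rankOne (p.W α) (p.V α)).det ≠ 0
  one_add_VW : ∀ α, 1 + p.V α ⬝ᵥ p.W α ≠ 0
  eq_zero : (1 + p.X 0 * p.Y 0) * (1 + p.Y (-1) * p.X (-1))⁻¹ = (q 0 : ℂ) • decProd p.W p.V d
  eq_succ : ∀ s, s ≠ 0 → (1 + p.X s * p.Y s) * (1 + p.Y (s - 1) * p.X (s - 1))⁻¹ =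
    (q s : ℂ) • (1 : Matrix (Fin n) (Fin n) ℂ)
  eq_infty : ∏ α, (1 + p.V α ⬝ᵥ p.W α) = ((totalT q : ℂ) ^ n)⁻¹

theorem IsCyclic.smul {q : Fin m → ℂˣ} {p : CyclicData m n d} (h : IsCyclic q p)
    (g : Fin m → GL (Fin n) ℂ) : IsCyclic q (g • p) := by
  have hX : ∀ s, (g • p).X s = (g s).1 * p.X s * (g (s + 1))⁻¹.1 := fun _ => rfl
  have hY : ∀ s, (g • p).Y s = (g (s + 1)).1 * p.Y s * (g s)⁻¹.1 := fun _ => rfl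
  have hV : ∀ α, (g • p).V α = p.V α ᵥ* (g 0)⁻¹.1 := fun _ => rfl
  have hW : ∀ α, (g • p).W α = (g 0).1 *ᵥ p.W α := fun _ => rfl
  have hXY : ∀ s, 1 + (g • p).X s * (g • p).Y s = (g s).1 * (1 + p.X s * p.Y s) * (g s)⁻¹.1 :=
    fun s => by rw [hX, hY, one_add_conj]
  have hYX : ∀ s, 1 + (g • p).Y s * (g • p).X s =
      (g (s + 1)).1 * (1 + p.Y s * p.X s) * (g (s + 1))⁻¹.1 :=
    fun s => by rw [hX, hY, one_add_conj]
  have hVW : ∀ α, (g • p).V α ⬝ᵥ (g • p).W α = p.V α ⬝ᵥ p.W α :=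
    fun α => by rw [hV, hW, dotProduct_conj]
  refine ⟨fun s => ?_, fun s => ?_, fun α => ?_, fun α => ?_, ?_, fun s hs => ?_, ?_⟩
  · rw [hXY, conj_det]; exact h.det_XY s
  · rw [hYX, conj_det]; exact h.det_YX s
  · rw [hV, hW, rankOne_conj, conj_det]; exact h.det_WV α
  · rw [hVW]; exact h.one_add_VW α
  · have hd : decProd (g • p).W (g • p).V d = (g 0).1 * decProd p.W p.V d * (g 0)⁻¹.1 :=
      decProd_conj _ _ _ _
    have h0 : (-1 : Fin m) + 1 = 0 := by
      open Fin.CommRing in exact neg_add_cancel 1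
    rw [hXY, hYX, h0, conj_inv, conj_mul_conj, h.eq_zero, hd]
    simp only [Matrix.mul_smul, Matrix.smul_mul]
  · have h0 : s - 1 + 1 = s := by
      open Fin.CommRing in exact sub_add_cancel s 1
    rw [hXY, hYX, h0, conj_inv, conj_mul_conj, h.eq_succ s hs, conj_smul_one]
  · simp only [hVW]; exact h.eq_infty

variable (n d) in
/-- The representation variety. -/
def CyclicRep (q : Fin m → ℂˣ) : Type := {p : CyclicData m n d // IsCyclic q p}

instance (q : Fin m → ℂˣ) : MulAction (Fin m → GL (Fin n) ℂ) (CyclicRep n d q) where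
  smul g p := ⟨g • p.1, p.2.smul g⟩
  one_smul p := Subtype.ext (one_smul _ p.1)
  mul_smul g h p := Subtype.ext (mul_smul g h p.1)

variable (n d) in
/-- The regular functions on the representation variety: the polynomials in the entries of the
matrices and in the inverses of `det (Id + X_s Y_s) = det (Id + Y_s X_s)` and of
`1 + V_α W_α = det (Id + W_α V_α)`. -/
def cyclicFunctions (q : Fin m → ℂˣ) : Subalgebra ℂ (CyclicRep n d q → ℂ) :=
  Algebra.adjoin ℂ
    ({f | ∃ s i j, f = fun p => p.1.X s i j} ∪ {f | ∃ s i j, f = fun p => p.1.Y s i j} ∪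
     {f | ∃ α i, f = fun p => p.1.V α i} ∪ {f | ∃ α i, f = fun p => p.1.W α i} ∪
     {f | ∃ s, f = fun p => (1 + p.1.X s * p.1.Y s).det⁻¹} ∪
     {f | ∃ α, f = fun p => (1 + p.1.V α ⬝ᵥ p.1.W α)⁻¹})

variable (n d) in
/-- The multiplicative quiver variety `C_{n,q,d}(m)`. -/
noncomputable def cyclicSpace (q : Fin m → ℂˣ) : Scheme :=
  gitQuotient (Fin m → GL (Fin n) ℂ) (cyclicFunctions n d q)

variable (n d) in
/-- Its structure morphism. -/
noncomputable def cyclicStr (q : Fin m → ℂˣ) : cyclicSpace n d q ⟶ Spec (CommRingCat.of ℂ) :=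
  gitQuotientStr (Fin m → GL (Fin n) ℂ) (cyclicFunctions n d q)

/-- The point of the multiplicative quiver variety defined by `(X_s, Y_s, V_α, W_α)`. -/
noncomputable def cyclicPoint {q : Fin m → ℂˣ} (p : CyclicRep n d q) :
    Spec (CommRingCat.of ℂ) ⟶ cyclicSpace n d q :=
  gitQuotientPoint (Fin m → GL (Fin n) ℂ) (cyclicFunctions n d q) p

variable (n d) in
/-- The invariant regular function `∏_s det X_s`. -/
def detX (q : Fin m → ℂˣ) : invariants (Fin m → GL (Fin n) ℂ) (cyclicFunctions n d q) :=
  ⟨fun p => ∏ s, (p.1.X s).det, by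
    constructor
    · have h : (fun p : CyclicRep n d q => ∏ s, (p.1.X s).det) =
          ∏ s, ∑ σ : Equiv.Perm (Fin n), (Equiv.Perm.sign σ : ℤ) •
            ∏ i, (fun p : CyclicRep n d q => p.1.X s (σ i) i) := by
        funext p
        simp [Matrix.det_apply, Finset.prod_apply, Finset.sum_apply, Units.smul_def]
      rw [h]
      refine Subalgebra.prod_mem _ fun s _ => Subalgebra.sum_mem _ fun σ _ =>
        Subalgebra.zsmul_mem _ (Subalgebra.prod_mem _ fun i _ => Algebra.subset_adjoin ?_) _
      exact Or.inl (Or.inl (Or.inl (Or.inl (Or.inl ⟨s, σ i, i, rfl⟩))))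
    · intro g p
      change ∏ s, ((g s).1 * p.1.X s * (g (s + 1))⁻¹.1).det = ∏ s, (p.1.X s).det
      simp only [Matrix.det_mul, Finset.prod_mul_distrib]
      have h1 : ∏ s : Fin m, ((g (s + 1))⁻¹.1 : Matrix (Fin n) (Fin n) ℂ).det =
          ∏ s, ((g s)⁻¹.1 : Matrix (Fin n) (Fin n) ℂ).det := by
        open Fin.CommRing in
        exact Equiv.prod_comp (Equiv.addRight (1 : Fin m))
          (fun s => ((g s)⁻¹.1 : Matrix (Fin n) (Fin n) ℂ).det)
      have h2 : (∏ s, (g s).1.det) * ∏ s, ((g s)⁻¹.1 : Matrix (Fin n) (Fin n) ℂ).det = 1 := by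
        rw [← Finset.prod_mul_distrib]
        refine Finset.prod_eq_one fun s _ => ?_
        rw [← Matrix.det_mul, show (g s).1 * (g s)⁻¹.1 = 1 from (g s).mul_inv, Matrix.det_one]
      rw [h1, mul_right_comm, h2, one_mul]⟩

variable (n d) in
/-- The open subset `C°_{n,q,d}(m)` of `C_{n,q,d}(m)` on which all `X_s` are invertible. -/
noncomputable def cyclicOpen (q : Fin m → ℂˣ) : (cyclicSpace n d q).Opens :=
  PrimeSpectrum.basicOpen (detX n d q)

/-- `Z_s = Y_s + X_s⁻¹`, used where `X_s` is invertible. -/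
noncomputable def CyclicData.Z (p : CyclicData m n d) (s : Fin m) : Matrix (Fin n) (Fin n) ℂ :=
  p.Y s + (p.X s)⁻¹

/-- `p = (X_s, Y_s, V_α, W_α)` is the representative assigned to `τ = (A, B, V', W')`:
in terms of the matrices `𝐀, 𝐂` of `τ` and `𝐀^{(m)}, 𝐂^{(m)}` of `p`, one has
`X_s = Id`, `Z_s = t_s B` for `s ≠ m - 1`, `X_{m-1} = A`, `Z_{m-1} = t A⁻¹ B`,
`𝐀^{(m)} = A⁻¹ 𝐀` and `𝐂^{(m)} = 𝐂`. -/
structure IsImage {q : Fin m → ℂˣ} (τ : TadpoleRep n d (totalT q)) (p : CyclicRep n d q) :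
    Prop where
  X_eq : ∀ s, s ≠ -1 → p.1.X s = 1
  Z_eq : ∀ s, s ≠ -1 → p.1.Z s = (partialT q s : ℂ) • τ.1.B
  X_last : p.1.X (-1) = τ.1.A
  Z_last : p.1.Z (-1) = (totalT q : ℂ) • (τ.1.A⁻¹ * τ.1.B)
  spinA_eq : spinA p.1.W = τ.1.A⁻¹ * spinA τ.1.W
  spinC_eq : (totalT q : ℂ)⁻¹ • spinC p.1.W p.1.V (p.1.Z (-1)) = spinC τ.1.W τ.1.V τ.1.B

end Cyclic

end SpinRS

/-!
Where all `X_s` are invertible, put `Z_s = Y_s + X_s⁻¹`, so that `Id + X_s Y_s = X_s Z_s` and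
`Id + Y_s X_s = Z_s X_s`. The change of basis `g_s = X_0 ⋯ X_{s-1}` makes `X_s = Id` for
`s ≠ m - 1`, and the moment map equations at the vertices `s ≠ 0` become
`Z_s = q_s Z_{s-1}` for `s ≠ m - 1` and `X_{m-1} Z_{m-1} = q_{m-1} Z_{m-2}`. All `Z_s` are
therefore determined by `A = X_0 ⋯ X_{m-1}` and `B = q_0⁻¹ (Id + X_0 Y_0)`. In terms of
`V' = V A⁻¹` and `W' = A W` the remaining equation, at the vertex `0`, is the moment map equation
of the spin Ruijsenaars–Schneider space, and its determinant is the equation at `∞`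
(`isCyclic_imageData`, `isTadpole_tadpoleData`). The residual gauge group is the diagonal `GL_n`
(`orbitRel_iff`). Hence `imageRep : T → R` and `tadpoleRep`, defined on the locus `R° ⊆ R` where
all `X_s` are invertible, are mutually inverse up to the group actions (`gauge_smul`).

That `V'` is forced by the matrix `𝐂` is a triangular induction on `α` (`eq_of_spinC_eq`).

For the quotients, pullback along `imageRep` maps the invariants of `R` to those of `T`. It makes
the invariants of `T` the localization of the invariants of `R` at `∏ det X_s`:
`∏ det X_s` pulls back to the unit `det A`; two invariants with the same pullback agree on `R°`,
hence after multiplication by `∏ det X_s`; and an invariant `F` of `T` composed with `tadpoleRep`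
is a regular function divided by a power of `∏ det X_s` (`exists_tadpoleRep_mul_pow`), which one
further factor `∏ det X_s` extends to an invariant on `R`. The spectrum of the localization is
the basic open subset `∏ det X_s ≠ 0`.
-/

namespace SpinRS

/-! ### Products of rank one perturbations of the identity -/

theorem det_rankOne {n : ℕ} (W V : Fin n → ℂ) : (rankOne W V).det = 1 + V ⬝ᵥ W := by
  rw [rankOne, vecMulVec_eq Unit, det_one_add_replicateCol_mul_replicateRow]

section RankOneProducts

variable {n d : ℕ} (W V : Fin d → Fin n → ℂ)

theorem det_list_prod (l : List (Matrix (Fin n) (Fin n) ℂ)) :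
    l.prod.det = (l.map Matrix.det).prod :=
  map_list_prod Matrix.detMonoidHom l

theorem det_decProd_ne_zero (h : ∀ α, (rankOne (W α) (V α)).det ≠ 0) (k : ℕ) :
    (decProd W V k).det ≠ 0 := by
  rw [decProd, det_list_prod]
  refine List.prod_ne_zero fun h0 => ?_
  obtain ⟨M, hM, h0⟩ := List.mem_map.1 h0
  obtain ⟨α, rfl⟩ := List.mem_ofFn.1 (List.mem_of_mem_take (List.mem_reverse.1 hM))
  exact h α h0

theorem decProd_self : decProd W V d = (List.ofFn fun α => rankOne (W α) (V α)).reverse.prod := by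
  rw [decProd, List.take_of_length_le (by simp)]

theorem prod_inv_rankOne :
    (List.ofFn fun α => (rankOne (W α) (V α))⁻¹).prod = (decProd W V d)⁻¹ := by
  rw [decProd_self, Matrix.list_prod_inv_reverse, List.reverse_reverse, List.map_ofFn]
  rfl

theorem det_decProd_self : (decProd W V d).det = ∏ α, (1 + V α ⬝ᵥ W α) := by
  rw [decProd_self, det_list_prod, List.map_reverse, List.prod_reverse, List.map_ofFn,
    List.prod_ofFn]
  simp [det_rankOne]

variable {W V}

theorem decProd_congr {W' V' : Fin d → Fin n → ℂ} {k : ℕ}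
    (h : ∀ α : Fin d, α.1 < k → W α = W' α ∧ V α = V' α) : decProd W V k = decProd W' V' k := by
  unfold decProd
  congr 2
  refine List.ext_getElem (by simp) fun i h1 h2 => ?_
  have hi : i < k := by simp at h1; omega
  have hd : i < d := by simp at h1; omega
  simp [(h ⟨i, hd⟩ hi).1, (h ⟨i, hd⟩ hi).2]

/-- The matrix `spinC W V Z` determines the rows `V α` once `W` and the invertible matrix `Z`
are given: the factor of `V α` only involves the rows of smaller index. -/
theorem eq_of_spinC_eq {V' : Fin d → Fin n → ℂ} {Z : Matrix (Fin n) (Fin n) ℂ} (hZ : Z.det ≠ 0)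
    (hW : ∀ α, (rankOne (W α) (V α)).det ≠ 0) (h : spinC W V Z = spinC W V' Z) : V = V' := by
  have key : ∀ k : ℕ, ∀ α : Fin d, α.1 < k → V α = V' α := by
    intro k
    induction k with
    | zero => intro α hα; omega
    | succ k ih =>
      intro α hα
      have h1 : decProd W V α = decProd W V' α :=
        decProd_congr fun β hβ => ⟨rfl, ih β (by omega)⟩
      have h2 : V α ᵥ* (decProd W V α * Z) = V' α ᵥ* (decProd W V α * Z) := by
        funext j
        have := congrFun (congrFun h α) j
        simpa [spinC, ← h1] using this
      have h3 : IsUnit (decProd W V α * Z) := by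
        rw [Matrix.isUnit_iff_isUnit_det, Matrix.det_mul]
        exact (mul_ne_zero (det_decProd_ne_zero W V hW _) hZ).isUnit
      exact Matrix.vecMul_injective_of_isUnit h3 h2
  exact funext fun α => key (α.1 + 1) α (Nat.lt_succ_self _)

end RankOneProducts

/-- An invertible matrix as an element of the general linear group. -/
noncomputable abbrev toGL {n : ℕ} (M : Matrix (Fin n) (Fin n) ℂ) (h : M.det ≠ 0) : GL (Fin n) ℂ :=
  Matrix.GeneralLinearGroup.mkOfDetNeZero M h

theorem toGL_inv_val {n : ℕ} (M : Matrix (Fin n) (Fin n) ℂ) (h : M.det ≠ 0) :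
    (toGL M h)⁻¹.1 = M⁻¹ := by
  rw [Matrix.coe_units_inv]; rfl

/-! ### Indices on the cycle -/

section Indices

variable {m : ℕ} [NeZero m]

theorem val_neg_one : ((-1 : Fin m)).1 + 1 = m := by
  obtain ⟨k, rfl⟩ : ∃ k, m = k + 1 := ⟨m - 1, (Nat.succ_pred (NeZero.ne m)).symm⟩
  have := Fin.coe_neg_one (n := k)
  exact congrArg (· + 1) this

theorem val_add_one_of_ne {s : Fin m} (h : s ≠ -1) : (s + 1).1 = s.1 + 1 := by
  have h1 : s.1 + 1 < m := by
    have := val_neg_one (m := m)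
    have h2 : s.1 ≠ (-1 : Fin m).1 := fun h' => h (Fin.ext h')
    omega
  exact Fin.val_add_one_of_lt' h1

theorem sub_one_ne {s : Fin m} (h : s ≠ 0) : s - 1 ≠ -1 := by
  open Fin.CommRing in
  intro h'
  exact h (by rw [← sub_add_cancel s 1, h', neg_add_cancel])

theorem fin_sub_add_cancel (s : Fin m) : s - 1 + 1 = s := by
  open Fin.CommRing in exact sub_add_cancel s 1

theorem fin_neg_one_add_one : (-1 : Fin m) + 1 = 0 := by
  open Fin.CommRing in exact neg_add_cancel 1

theorem val_sub_one {s : Fin m} (h : s ≠ 0) : s.1 = (s - 1).1 + 1 := by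
  rw [← val_add_one_of_ne (sub_one_ne h), fin_sub_add_cancel]

theorem zero_ne_neg_one (hm : 2 ≤ m) : (0 : Fin m) ≠ -1 := by
  intro h
  have := val_neg_one (m := m)
  rw [← h, Fin.val_zero] at this
  omega

/-- Induction along the cycle, started at the vertex `0`. -/
theorem cyclic_induction {P : Fin m → Prop} (h0 : P 0) (h : ∀ s, s ≠ 0 → P (s - 1) → P s) :
    ∀ s, P s := by
  have key : ∀ k : ℕ, ∀ s : Fin m, s.1 = k → P s := by
    intro k
    induction k with
    | zero => intro s hs; rwa [show s = 0 from Fin.ext (by simpa using hs)]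
    | succ k ih =>
      intro s hs
      have h1 : s ≠ 0 := by rintro rfl; simp at hs
      exact h s h1 (ih _ (by have := val_sub_one h1; omega))
  exact fun s => key _ s rfl

theorem partialT_zero (q : Fin m → ℂˣ) : partialT q 0 = q 0 := by
  have : Finset.Iic (0 : Fin m) = {0} := by
    ext x; simp
  rw [partialT, this, Finset.prod_singleton]

theorem partialT_of_ne (q : Fin m → ℂˣ) {s : Fin m} (h : s ≠ 0) :
    partialT q s = q s * partialT q (s - 1) := by
  have : Finset.Iic s = insert s (Finset.Iic (s - 1)) := by
    ext x
    have := val_sub_one h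
    simp only [Finset.mem_Iic, Finset.mem_insert, Fin.le_def, Fin.ext_iff]
    omega
  rw [partialT, this, Finset.prod_insert, partialT]
  have := val_sub_one h
  simp only [Finset.mem_Iic, Fin.le_def]
  omega

theorem partialT_neg_one (q : Fin m → ℂˣ) : partialT q (-1) = totalT q := by
  have : Finset.Iic (-1 : Fin m) = Finset.univ := by
    ext x
    have := val_neg_one (m := m)
    simp only [Finset.mem_Iic, Finset.mem_univ, Fin.le_def, iff_true]
    omega
  rw [partialT, this, totalT]

end Indices

/-! ### The representative attached to a point of the spin Ruijsenaars–Schneider space -/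

theorem CyclicData.one_add_XY {m n d : ℕ} {p : CyclicData m n d} {s : Fin m} (h : (p.X s).det ≠ 0) :
    1 + p.X s * p.Y s = p.X s * p.Z s := by
  rw [CyclicData.Z, Matrix.mul_add, Matrix.mul_nonsing_inv _ h.isUnit, add_comm]

theorem CyclicData.one_add_YX {m n d : ℕ} {p : CyclicData m n d} {s : Fin m} (h : (p.X s).det ≠ 0) :
    1 + p.Y s * p.X s = p.Z s * p.X s := by
  rw [CyclicData.Z, Matrix.add_mul, Matrix.nonsing_inv_mul _ h.isUnit, add_comm]

section Image

variable {m n d : ℕ} [NeZero m]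

/-- The data `X_s = Id`, `Z_s = t_s B` for `s ≠ m - 1`, `X_{m-1} = A`, `Z_{m-1} = t A⁻¹ B`,
`W_α = A⁻¹ W'_α`, `V_α = V'_α A`, with `Y_s = Z_s - X_s⁻¹`. -/
noncomputable def imageData (q : Fin m → ℂˣ) (τ : TadpoleData n d) : CyclicData m n d where
  X s := if s = -1 then τ.A else 1
  Y s := if s = -1 then (totalT q : ℂ) • (τ.A⁻¹ * τ.B) - τ.A⁻¹ else (partialT q s : ℂ) • τ.B - 1
  V α := τ.V α ᵥ* τ.A
  W α := τ.A⁻¹ *ᵥ τ.W α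

variable (q : Fin m → ℂˣ) (τ : TadpoleData n d)

theorem imageData_X_of_ne {s : Fin m} (h : s ≠ -1) : (imageData q τ).X s = 1 := if_neg h

theorem imageData_X_last : (imageData q τ).X (-1) = τ.A := if_pos rfl

theorem imageData_Y_of_ne {s : Fin m} (h : s ≠ -1) :
    (imageData q τ).Y s = (partialT q s : ℂ) • τ.B - 1 := if_neg h

theorem imageData_Y_last :
    (imageData q τ).Y (-1) = (totalT q : ℂ) • (τ.A⁻¹ * τ.B) - τ.A⁻¹ := if_pos rfl

theorem imageData_Z_of_ne {s : Fin m} (h : s ≠ -1) :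
    (imageData q τ).Z s = (partialT q s : ℂ) • τ.B := by
  rw [CyclicData.Z, imageData_X_of_ne q τ h, imageData_Y_of_ne q τ h, inv_one, sub_add_cancel]

theorem imageData_Z_last :
    (imageData q τ).Z (-1) = (totalT q : ℂ) • (τ.A⁻¹ * τ.B) := by
  rw [CyclicData.Z, imageData_X_last, imageData_Y_last, sub_add_cancel]

variable {τ}

theorem imageData_X_det (hA : τ.A.det ≠ 0) (s : Fin m) : ((imageData q τ).X s).det ≠ 0 := by
  by_cases h : s = -1
  · subst h; rwa [imageData_X_last]
  · rw [imageData_X_of_ne q τ h, Matrix.det_one]; exact one_ne_zero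

theorem imageData_XY (hA : τ.A.det ≠ 0) (s : Fin m) :
    1 + (imageData q τ).X s * (imageData q τ).Y s = (partialT q s : ℂ) • τ.B := by
  rw [CyclicData.one_add_XY (imageData_X_det q hA s)]
  by_cases h : s = -1
  · subst h
    rw [imageData_X_last, imageData_Z_last, Matrix.mul_smul, ← Matrix.mul_assoc,
      Matrix.mul_nonsing_inv _ hA.isUnit, Matrix.one_mul, partialT_neg_one]
  · rw [imageData_X_of_ne q τ h, imageData_Z_of_ne q τ h, Matrix.one_mul]

theorem imageData_YX_of_ne (hA : τ.A.det ≠ 0) {s : Fin m} (h : s ≠ -1) :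
    1 + (imageData q τ).Y s * (imageData q τ).X s = (partialT q s : ℂ) • τ.B := by
  rw [CyclicData.one_add_YX (imageData_X_det q hA s), imageData_X_of_ne q τ h,
    imageData_Z_of_ne q τ h, Matrix.mul_one]

theorem imageData_YX_last (hA : τ.A.det ≠ 0) :
    1 + (imageData q τ).Y (-1) * (imageData q τ).X (-1) =
      (totalT q : ℂ) • (τ.A⁻¹ * τ.B * τ.A) := by
  rw [CyclicData.one_add_YX (imageData_X_det q hA _), imageData_X_last, imageData_Z_last,
    Matrix.smul_mul]

theorem rankOne_imageData (hA : τ.A.det ≠ 0) (α : Fin d) :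
    rankOne ((imageData q τ).W α) ((imageData q τ).V α) =
      τ.A⁻¹ * rankOne (τ.W α) (τ.V α) * τ.A := by
  have h := rankOne_conj (toGL τ.A hA)⁻¹ (τ.W α) (τ.V α)
  rw [inv_inv, toGL_inv_val] at h
  exact h

theorem decProd_imageData (hA : τ.A.det ≠ 0) (k : ℕ) :
    decProd (imageData q τ).W (imageData q τ).V k = τ.A⁻¹ * decProd τ.W τ.V k * τ.A := by
  have h := decProd_conj (toGL τ.A hA)⁻¹ τ.W τ.V k
  rw [inv_inv, toGL_inv_val] at h
  exact h

theorem det_inv_conj {A M : Matrix (Fin n) (Fin n) ℂ} (hA : A.det ≠ 0) :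
    (A⁻¹ * M * A).det = M.det := by
  rw [Matrix.det_mul_comm, ← Matrix.mul_assoc, Matrix.mul_nonsing_inv _ hA.isUnit, Matrix.one_mul]

theorem units_smul_inv (c : ℂˣ) (M : Matrix (Fin n) (Fin n) ℂ) :
    ((c : ℂ) • M)⁻¹ = ((c⁻¹ : ℂˣ) : ℂ) • M⁻¹ := by
  by_cases h : M.det = 0
  · rw [Matrix.nonsing_inv_apply_not_isUnit M (by simp [h]),
      Matrix.nonsing_inv_apply_not_isUnit _ (by simp [h]), smul_zero]
  · exact Matrix.inv_smul' M c (Ne.isUnit h)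

/-- The moment map equation, with the factors `Id + W'_α V'_α` moved to the right-hand side. -/
theorem IsTadpole.commutator_eq {t : ℂˣ} (h : IsTadpole t τ) :
    τ.A * τ.B * τ.A⁻¹ * τ.B⁻¹ = (t : ℂ) • decProd τ.W τ.V d := by
  have h1 := h.momentMap
  rw [prod_inv_rankOne] at h1
  have hD := (det_decProd_ne_zero τ.W τ.V h.det_WV d).isUnit
  calc _ = τ.A * τ.B * τ.A⁻¹ * τ.B⁻¹ * (decProd τ.W τ.V d)⁻¹ * decProd τ.W τ.V d := by
        rw [Matrix.mul_assoc _ _ (decProd τ.W τ.V d), Matrix.nonsing_inv_mul _ hD, Matrix.mul_one]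
    _ = _ := by rw [h1, Matrix.smul_mul, Matrix.one_mul]

theorem isCyclic_imageData (h : IsTadpole (totalT q) τ) :
    IsCyclic q (imageData q τ) := by
  have hA := h.det_A
  have hB := h.det_B
  have hA' := hA.isUnit
  have hB' := hB.isUnit
  have hR : ∀ α, 1 + (imageData q τ).V α ⬝ᵥ (imageData q τ).W α = 1 + τ.V α ⬝ᵥ τ.W α := by
    intro α
    rw [← det_rankOne, rankOne_imageData q hA, det_inv_conj hA, det_rankOne]
  refine ⟨fun s => ?_, fun s => ?_, fun α => ?_, fun α => ?_, ?_, fun s hs => ?_, ?_⟩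
  · rw [imageData_XY q hA, Matrix.det_smul]
    exact mul_ne_zero (pow_ne_zero _ (Units.ne_zero _)) hB
  · rw [Matrix.det_one_add_mul_comm, imageData_XY q hA, Matrix.det_smul]
    exact mul_ne_zero (pow_ne_zero _ (Units.ne_zero _)) hB
  · rw [rankOne_imageData q hA, det_inv_conj hA]; exact h.det_WV α
  · rw [hR, ← det_rankOne]; exact h.det_WV α
  · rw [imageData_XY q hA, imageData_YX_last q hA, units_smul_inv, decProd_imageData q hA,
      partialT_zero]
    have h1 : decProd τ.W τ.V d =
        (((totalT q)⁻¹ : ℂˣ) : ℂ) • (τ.A * τ.B * τ.A⁻¹ * τ.B⁻¹) := by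
      rw [h.commutator_eq, smul_smul, ← Units.val_mul, inv_mul_cancel, Units.val_one, one_smul]
    rw [h1]
    simp only [Matrix.mul_inv_rev, Matrix.nonsing_inv_nonsing_inv _ hA', Matrix.smul_mul,
      Matrix.mul_smul, ← Matrix.mul_assoc, Matrix.nonsing_inv_mul _ hA', Matrix.one_mul]
    exact smul_comm _ _ _
  · rw [imageData_XY q hA, imageData_YX_of_ne q hA (sub_one_ne hs), units_smul_inv,
      Matrix.smul_mul, Matrix.mul_smul, Matrix.mul_nonsing_inv _ hB', smul_smul,
      partialT_of_ne q hs, ← Units.val_mul, mul_inv_cancel_right]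
  -- The commutator of `A` and `B` has determinant one.
  · have h1 := congrArg Matrix.det h.commutator_eq
    have h2 : (τ.A * τ.B * τ.A⁻¹ * τ.B⁻¹).det = 1 := by
      simp only [Matrix.det_mul, Matrix.det_nonsing_inv, Ring.inverse_eq_inv']
      field_simp
    rw [h2, Matrix.det_smul, det_decProd_self, Fintype.card_fin] at h1
    simp only [hR]
    exact eq_inv_of_mul_eq_one_right h1.symm

/-- The map `ψ` on points: the representative assigned to a point of `TadpoleRep`. -/
noncomputable def imageRep (τ : TadpoleRep n d (totalT q)) : CyclicRep n d q :=
  ⟨imageData q τ.1, isCyclic_imageData q τ.2⟩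

theorem isImage_iff (τ : TadpoleRep n d (totalT q)) (p : CyclicRep n d q) :
    IsImage τ p ↔ p = imageRep q τ := by
  have hA := τ.2.det_A
  have hB := τ.2.det_B
  have hA' := hA.isUnit
  have hspin : spinC (imageData q τ.1).W (imageData q τ.1).V ((imageData q τ.1).Z (-1)) =
      (totalT q : ℂ) • spinC τ.1.W τ.1.V τ.1.B := by
    ext α j
    have h1 : (imageData q τ.1).V α ᵥ* (decProd (imageData q τ.1).W (imageData q τ.1).V α *
        (imageData q τ.1).Z (-1)) =
        (totalT q : ℂ) • (τ.1.V α ᵥ* (decProd τ.1.W τ.1.V α * τ.1.B)) := by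
      rw [decProd_imageData q hA, imageData_Z_last, ← Matrix.vecMul_smul]
      change (τ.1.V α ᵥ* τ.1.A) ᵥ* _ = _
      rw [Matrix.vecMul_vecMul]
      congr 1
      simp only [Matrix.mul_smul, ← Matrix.mul_assoc, Matrix.mul_nonsing_inv _ hA',
        Matrix.one_mul]
      rw [Matrix.mul_assoc _ τ.1.A, Matrix.mul_nonsing_inv _ hA', Matrix.mul_one]
    exact congrFun h1 j
  constructor
  · intro h
    have hX : p.1.X = (imageData q τ.1).X := by
      funext s
      by_cases hs : s = -1
      · subst hs; rw [h.X_last, imageData_X_last]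
      · rw [h.X_eq s hs, imageData_X_of_ne _ _ hs]
    have hZ : ∀ s, p.1.Z s = (imageData q τ.1).Z s := by
      intro s
      by_cases hs : s = -1
      · subst hs; rw [h.Z_last, imageData_Z_last]
      · rw [h.Z_eq s hs, imageData_Z_of_ne _ _ hs]
    have hY : p.1.Y = (imageData q τ.1).Y := by
      funext s
      have := hZ s
      rw [CyclicData.Z, CyclicData.Z, hX] at this
      exact add_right_cancel this
    have hW : p.1.W = (imageData q τ.1).W := by
      funext α i
      exact congrFun (congrFun h.spinA_eq i) α
    have hV : p.1.V = (imageData q τ.1).V := by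
      have h1 := h.spinC_eq
      rw [inv_smul_eq_iff₀ (Units.ne_zero _), ← hspin, hZ, hW] at h1
      refine eq_of_spinC_eq ?_ (fun α => hW ▸ p.2.det_WV α) h1
      rw [imageData_Z_last, Matrix.det_smul, Matrix.det_mul, Matrix.det_nonsing_inv,
        Ring.inverse_eq_inv']
      exact mul_ne_zero (pow_ne_zero _ (Units.ne_zero _)) (mul_ne_zero (inv_ne_zero hA) hB)
    exact Subtype.ext (CyclicData.ext hX hY hV hW)
  · rintro rfl
    refine ⟨fun s hs => imageData_X_of_ne q _ hs, fun s hs => imageData_Z_of_ne q _ hs,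
      imageData_X_last q _, imageData_Z_last q _, rfl, ?_⟩
    rw [inv_smul_eq_iff₀ (Units.ne_zero _)]
    exact hspin

/-- A change of basis of `τ` changes its representative by the same matrix at every vertex. -/
theorem imageRep_smul (g : GL (Fin n) ℂ) (τ : TadpoleRep n d (totalT q)) :
    imageRep q (g • τ) = (fun _ => g : Fin m → GL (Fin n) ℂ) • imageRep q τ := by
  have h2 : g.1 * g⁻¹.1 = 1 := g.mul_inv
  have h3 : g⁻¹.1 * g.1 = 1 := g.inv_mul
  refine Subtype.ext (CyclicData.ext ?_ ?_ ?_ ?_)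
  · funext s
    change (if s = -1 then g.1 * τ.1.A * g⁻¹.1 else 1) =
      g.1 * (if s = -1 then τ.1.A else 1) * g⁻¹.1
    split_ifs
    · rfl
    · rw [Matrix.mul_one, h2]
  · funext s
    change (if s = -1 then (totalT q : ℂ) • ((g.1 * τ.1.A * g⁻¹.1)⁻¹ * (g.1 * τ.1.B * g⁻¹.1)) -
        (g.1 * τ.1.A * g⁻¹.1)⁻¹ else (partialT q s : ℂ) • (g.1 * τ.1.B * g⁻¹.1) - 1) =
      g.1 * (if s = -1 then (totalT q : ℂ) • (τ.1.A⁻¹ * τ.1.B) - τ.1.A⁻¹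
        else (partialT q s : ℂ) • τ.1.B - 1) * g⁻¹.1
    split_ifs
    · rw [conj_inv, conj_mul_conj, Matrix.mul_sub, Matrix.sub_mul, Matrix.mul_smul,
        Matrix.smul_mul]
    · rw [Matrix.mul_sub, Matrix.sub_mul, Matrix.mul_smul, Matrix.smul_mul, Matrix.mul_one, h2]
  · funext α
    change (τ.1.V α ᵥ* g⁻¹.1) ᵥ* (g.1 * τ.1.A * g⁻¹.1) = (τ.1.V α ᵥ* τ.1.A) ᵥ* g⁻¹.1
    rw [Matrix.vecMul_vecMul, Matrix.vecMul_vecMul, ← Matrix.mul_assoc, ← Matrix.mul_assoc, h3,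
      Matrix.one_mul]
  · funext α
    change (g.1 * τ.1.A * g⁻¹.1)⁻¹ *ᵥ (g.1 *ᵥ τ.1.W α) = g.1 *ᵥ (τ.1.A⁻¹ *ᵥ τ.1.W α)
    rw [conj_inv, Matrix.mulVec_mulVec, Matrix.mulVec_mulVec, Matrix.mul_assoc _ g⁻¹.1, h3,
      Matrix.mul_one]

/-- Elements of `∏ GL_n` carrying one representative to another are constant along the cycle,
because `X_s = Id` for `s ≠ m - 1`. -/
theorem orbitRel_iff (hm : 2 ≤ m) (τ τ' : TadpoleRep n d (totalT q)) :
    MulAction.orbitRel (GL (Fin n) ℂ) _ τ τ' ↔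
      MulAction.orbitRel (Fin m → GL (Fin n) ℂ) _ (imageRep q τ) (imageRep q τ') := by
  constructor
  · rintro ⟨g, rfl⟩
    exact ⟨fun _ => g, (imageRep_smul q g τ').symm⟩
  · rintro ⟨g, hg⟩
    have hg : g • imageData q τ'.1 = imageData q τ.1 := congrArg Subtype.val hg
    have hX : ∀ s, (g s).1 * (imageData q τ'.1).X s * (g (s + 1))⁻¹.1 = (imageData q τ.1).X s :=
      fun s => congrFun (congrArg CyclicData.X hg) s
    have hconst : ∀ s, g s = g 0 := by
      refine cyclic_induction rfl fun s hs ih => ?_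
      have h1 := hX (s - 1)
      rw [imageData_X_of_ne _ _ (sub_one_ne hs), imageData_X_of_ne _ _ (sub_one_ne hs),
        fin_sub_add_cancel, Matrix.mul_one] at h1
      have h2 : g (s - 1) * (g s)⁻¹ = 1 := Units.ext h1
      rw [← ih]; exact (mul_inv_eq_one.1 h2).symm
    refine ⟨g 0, ?_⟩
    have h1 : imageRep q (g 0 • τ') = imageRep q τ := by
      rw [imageRep_smul, show (fun _ => g 0) = g from funext fun s => (hconst s).symm]
      exact Subtype.ext hg
    have h1 : imageData q (g 0 • τ').1 = imageData q τ.1 := congrArg Subtype.val h1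
    have hA : (g 0 • τ').1.A = τ.1.A := by
      rw [← imageData_X_last q, h1, imageData_X_last]
    have hAu := τ.2.det_A.isUnit
    refine Subtype.ext (TadpoleData.ext hA ?_ ?_ ?_)
    · have h2 := imageData_Z_of_ne q (g 0 • τ').1 (zero_ne_neg_one hm)
      rw [h1, imageData_Z_of_ne q _ (zero_ne_neg_one hm)] at h2
      exact (smul_right_injective _ (Units.ne_zero (partialT q 0)) h2).symm
    · funext α
      have h2 : (g 0 • τ').1.V α ᵥ* (g 0 • τ').1.A = τ.1.V α ᵥ* τ.1.A :=
        congrFun (congrArg CyclicData.V h1) α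
      rw [hA] at h2
      exact Matrix.vecMul_injective_of_isUnit ((Matrix.isUnit_iff_isUnit_det _).2 hAu) h2
    · funext α
      have h2 : (g 0 • τ').1.A⁻¹ *ᵥ (g 0 • τ').1.W α = τ.1.A⁻¹ *ᵥ τ.1.W α :=
        congrFun (congrArg CyclicData.W h1) α
      rw [hA] at h2
      exact Matrix.mulVec_injective_of_isUnit
        ((Matrix.isUnit_nonsing_inv_iff).2 ((Matrix.isUnit_iff_isUnit_det _).2 hAu)) h2

end Image

/-! ### Gauge fixing where all `X_s` are invertible -/

section Gauge

variable {m n d : ℕ}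

/-- The product `X_0 X_1 ⋯ X_{k-1}` along the cycle. -/
def prodX (p : CyclicData m n d) (k : ℕ) : Matrix (Fin n) (Fin n) ℂ :=
  ((List.ofFn p.X).take k).prod

theorem prodX_zero (p : CyclicData m n d) : prodX p 0 = 1 := by simp [prodX]

theorem prodX_succ (p : CyclicData m n d) (s : Fin m) :
    prodX p (s.1 + 1) = prodX p s.1 * p.X s := by
  rw [prodX, List.prod_take_succ _ _ (by simp)]
  simp [prodX]

theorem prodX_self (p : CyclicData m n d) : prodX p m = (List.ofFn p.X).prod := by
  rw [prodX, List.take_of_length_le (by simp)]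

theorem det_prodX_self (p : CyclicData m n d) : (prodX p m).det = ∏ s, (p.X s).det := by
  rw [prodX_self, det_list_prod, List.map_ofFn, List.prod_ofFn]; rfl

theorem det_prodX_ne_zero {p : CyclicData m n d} (h : ∀ s, (p.X s).det ≠ 0) (k : ℕ) :
    (prodX p k).det ≠ 0 := by
  rw [prodX, det_list_prod]
  refine List.prod_ne_zero fun h0 => ?_
  obtain ⟨M, hM, h0⟩ := List.mem_map.1 h0
  obtain ⟨s, rfl⟩ := List.mem_ofFn.1 (List.mem_of_mem_take hM)
  exact h s h0

variable [NeZero m]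

/-- The change of basis `g_s = X_0 ⋯ X_{s-1}`, which turns `X_s` into `Id` for `s ≠ m - 1` and
`X_{m-1}` into the monodromy `X_0 ⋯ X_{m-1}`. -/
noncomputable def gauge (p : CyclicData m n d) (h : ∀ s, (p.X s).det ≠ 0) :
    Fin m → GL (Fin n) ℂ :=
  fun s => toGL (prodX p s.1) (det_prodX_ne_zero h _)

/-- The data `A = X_0 ⋯ X_{m-1}`, `B = q_0⁻¹ (Id + X_0 Y_0)`, `V'_α = V_α A⁻¹`, `W'_α = A W_α`,
read off at the vertex `0`. Where all `X_s` are invertible, this inverts `imageData` up to a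
change of basis. -/
noncomputable def tadpoleData (q : Fin m → ℂˣ) (p : CyclicData m n d) : TadpoleData n d where
  A := prodX p m
  B := (((q 0)⁻¹ : ℂˣ) : ℂ) • (1 + p.X 0 * p.Y 0)
  V α := p.V α ᵥ* (prodX p m)⁻¹
  W α := prodX p m *ᵥ p.W α

variable {q : Fin m → ℂˣ} {p : CyclicData m n d}

theorem prodX_last : prodX p m = prodX p (-1 : Fin m).1 * p.X (-1) := by
  rw [← prodX_succ, val_neg_one]

/-- The moment map equations propagate `Id + X_s Y_s`, transported to the vertex `0`,
along the cycle. -/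
theorem prodX_mul_one_add_XY (hp : IsCyclic q p) (s : Fin m) :
    prodX p s.1 * (1 + p.X s * p.Y s) =
      ((partialT q s : ℂ) • (tadpoleData q p).B) * prodX p s.1 := by
  have h1 : ∀ c : ℂˣ, (c : ℂ) • (((c⁻¹ : ℂˣ) : ℂ) • (1 + p.X 0 * p.Y 0)) = 1 + p.X 0 * p.Y 0 :=
    fun c => by rw [smul_smul, ← Units.val_mul, mul_inv_cancel, Units.val_one, one_smul]
  induction s using cyclic_induction with
  | h0 =>
    rw [Fin.val_zero, prodX_zero, Matrix.one_mul, Matrix.mul_one, partialT_zero]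
    exact (h1 _).symm
  | h s hs ih =>
    have hYX := (hp.det_YX (s - 1)).isUnit
    have h2 : 1 + p.X s * p.Y s = (q s : ℂ) • (1 + p.Y (s - 1) * p.X (s - 1)) := by
      have h3 := congrArg (· * (1 + p.Y (s - 1) * p.X (s - 1))) (hp.eq_succ s hs)
      simpa only [Matrix.mul_assoc, Matrix.nonsing_inv_mul _ hYX, Matrix.mul_one,
        Matrix.smul_mul, Matrix.one_mul] using h3
    have h4 : p.X (s - 1) * (1 + p.Y (s - 1) * p.X (s - 1)) =
        (1 + p.X (s - 1) * p.Y (s - 1)) * p.X (s - 1) := by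
      rw [Matrix.mul_add, Matrix.add_mul, Matrix.mul_one, Matrix.one_mul, Matrix.mul_assoc]
    rw [h2, val_sub_one hs, prodX_succ, Matrix.mul_smul, Matrix.mul_assoc, h4,
      ← Matrix.mul_assoc, ih, partialT_of_ne q hs, Units.val_mul, mul_smul]
    simp only [Matrix.smul_mul, Matrix.mul_assoc]

theorem tadpoleData_A_mul_YX (hp : IsCyclic q p) :
    prodX p m * (1 + p.Y (-1) * p.X (-1)) =
      (totalT q : ℂ) • ((tadpoleData q p).B * prodX p m) := by
  have h4 : p.X (-1) * (1 + p.Y (-1) * p.X (-1)) = (1 + p.X (-1) * p.Y (-1)) * p.X (-1) := by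
    rw [Matrix.mul_add, Matrix.add_mul, Matrix.mul_one, Matrix.one_mul, Matrix.mul_assoc]
  rw [prodX_last, Matrix.mul_assoc, h4, ← Matrix.mul_assoc, prodX_mul_one_add_XY hp,
    partialT_neg_one, Matrix.smul_mul, Matrix.smul_mul, Matrix.mul_assoc]

theorem rankOne_tadpoleData (h : ∀ s, (p.X s).det ≠ 0) (α : Fin d) :
    rankOne ((tadpoleData q p).W α) ((tadpoleData q p).V α) =
      prodX p m * rankOne (p.W α) (p.V α) * (prodX p m)⁻¹ := by
  have h1 := rankOne_conj (toGL _ (det_prodX_ne_zero h m)) (p.W α) (p.V α)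
  rw [toGL_inv_val] at h1
  exact h1

theorem decProd_tadpoleData (h : ∀ s, (p.X s).det ≠ 0) (k : ℕ) :
    decProd (tadpoleData q p).W (tadpoleData q p).V k =
      prodX p m * decProd p.W p.V k * (prodX p m)⁻¹ := by
  have h1 := decProd_conj (toGL _ (det_prodX_ne_zero h m)) p.W p.V k
  rw [toGL_inv_val] at h1
  exact h1

theorem det_rankOne_tadpoleData (h : ∀ s, (p.X s).det ≠ 0) (α : Fin d) :
    (rankOne ((tadpoleData q p).W α) ((tadpoleData q p).V α)).det =
      (rankOne (p.W α) (p.V α)).det := by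
  rw [rankOne_tadpoleData h, Matrix.det_mul_comm, ← Matrix.mul_assoc,
    Matrix.nonsing_inv_mul _ (det_prodX_ne_zero h m).isUnit, Matrix.one_mul]

theorem isTadpole_tadpoleData (h : ∀ s, (p.X s).det ≠ 0) (hp : IsCyclic q p) :
    IsTadpole (totalT q) (tadpoleData q p) := by
  have hA : (tadpoleData q p).A.det ≠ 0 := det_prodX_ne_zero h m
  have hB : (tadpoleData q p).B.det ≠ 0 := by
    change ((((q 0)⁻¹ : ℂˣ) : ℂ) • (1 + p.X 0 * p.Y 0)).det ≠ 0
    rw [Matrix.det_smul]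
    exact mul_ne_zero (pow_ne_zero _ (Units.ne_zero _)) (hp.det_XY 0)
  have hR : ∀ α, (rankOne ((tadpoleData q p).W α) ((tadpoleData q p).V α)).det ≠ 0 :=
    fun α => by rw [det_rankOne_tadpoleData h]; exact hp.det_WV α
  refine ⟨hA, hB, hR, ?_⟩
  have hYX := (hp.det_YX (-1)).isUnit
  have hB0 : (tadpoleData q p).B = decProd p.W p.V d * (1 + p.Y (-1) * p.X (-1)) := by
    have h1 : 1 + p.X 0 * p.Y 0 =
        (q 0 : ℂ) • (decProd p.W p.V d * (1 + p.Y (-1) * p.X (-1))) := by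
      rw [← Matrix.smul_mul, ← hp.eq_zero, Matrix.mul_assoc, Matrix.nonsing_inv_mul _ hYX,
        Matrix.mul_one]
    change (((q 0)⁻¹ : ℂˣ) : ℂ) • (1 + p.X 0 * p.Y 0) = _
    rw [h1, smul_smul, ← Units.val_mul, inv_mul_cancel, Units.val_one, one_smul]
  -- With `D = decProd p.W p.V d`, the two equations `B = D (Id + Y X)` and
  -- `A (Id + Y X) = t B A` give `A B = t (A D A⁻¹) B A`.
  have hAB : (tadpoleData q p).A * (tadpoleData q p).B = (totalT q : ℂ) •
      (decProd (tadpoleData q p).W (tadpoleData q p).V d *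
        ((tadpoleData q p).B * (tadpoleData q p).A)) := by
    rw [decProd_tadpoleData h, ← Matrix.mul_smul]
    change _ = _ * ((totalT q : ℂ) • ((tadpoleData q p).B * prodX p m))
    rw [← tadpoleData_A_mul_YX hp, Matrix.mul_assoc _ (prodX p m)⁻¹,
      ← Matrix.mul_assoc _ (prodX p m), Matrix.nonsing_inv_mul _ (det_prodX_ne_zero h m).isUnit, Matrix.one_mul, Matrix.mul_assoc,
      ← hB0]
    rfl
  have hD := (det_decProd_ne_zero _ _ hR d).isUnit
  rw [prod_inv_rankOne, hAB]
  simp only [Matrix.smul_mul]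
  congr 1
  rw [← Matrix.mul_assoc, Matrix.mul_assoc _ (tadpoleData q p).A,
    Matrix.mul_nonsing_inv _ hA.isUnit, Matrix.mul_one, Matrix.mul_assoc _ (tadpoleData q p).B,
    Matrix.mul_nonsing_inv _ hB.isUnit, Matrix.mul_one, Matrix.mul_nonsing_inv _ hD]

/-- Where all `X_s` are invertible, a point of the cyclic space is gauge equivalent to the
representative of its tadpole data. -/
theorem gauge_smul (h : ∀ s, (p.X s).det ≠ 0) (hp : IsCyclic q p) :
    gauge p h • p = imageData q (tadpoleData q p) := by
  have hu : ∀ k, IsUnit (prodX p k).det := fun k => (det_prodX_ne_zero h k).isUnit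
  have hz : (gauge p h 0).1 = 1 := by
    change prodX p (0 : Fin m).1 = 1
    rw [Fin.val_zero, prodX_zero]
  have hz' : (gauge p h 0)⁻¹.1 = 1 := by
    rw [Matrix.coe_units_inv, hz, inv_one]
  have hXY : ∀ s, prodX p s.1 * p.X s * p.Y s =
      ((partialT q s : ℂ) • (tadpoleData q p).B) * prodX p s.1 - prodX p s.1 := fun s => by
    have := prodX_mul_one_add_XY hp s
    rw [Matrix.mul_add, Matrix.mul_one] at this
    rw [← this, Matrix.mul_assoc, add_sub_cancel_left]
  have hginv : ∀ s, (gauge p h s)⁻¹.1 = (prodX p s.1)⁻¹ := fun s => toGL_inv_val _ _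
  refine CyclicData.ext ?_ ?_ ?_ ?_
  · funext s
    change (gauge p h s).1 * p.X s * (gauge p h (s + 1))⁻¹.1 = _
    change prodX p s.1 * p.X s * _ = _
    by_cases hs : s = -1
    · subst hs
      rw [imageData_X_last, fin_neg_one_add_one, hz', Matrix.mul_one, ← prodX_last]
      rfl
    · rw [hginv, imageData_X_of_ne _ _ hs, val_add_one_of_ne hs, ← prodX_succ,
        Matrix.mul_nonsing_inv _ (hu _)]
  · funext s
    change (gauge p h (s + 1)).1 * p.Y s * (gauge p h s)⁻¹.1 = _
    rw [hginv]
    by_cases hs : s = -1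
    · subst hs
      rw [imageData_Y_last, fin_neg_one_add_one, hz, Matrix.one_mul]
      change _ = (totalT q : ℂ) • ((prodX p m)⁻¹ * (tadpoleData q p).B) - (prodX p m)⁻¹
      have h1 := hXY (-1)
      rw [← prodX_last, partialT_neg_one] at h1
      have h2 : p.Y (-1) = (prodX p m)⁻¹ * (((totalT q : ℂ) • (tadpoleData q p).B) *
          prodX p (-1 : Fin m).1 - prodX p (-1 : Fin m).1) := by
        rw [← h1, ← Matrix.mul_assoc, Matrix.nonsing_inv_mul _ (hu m), Matrix.one_mul]
      rw [h2, Matrix.mul_assoc, Matrix.sub_mul, Matrix.mul_assoc,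
        Matrix.mul_nonsing_inv _ (hu _), Matrix.mul_one, Matrix.mul_sub, Matrix.mul_one,
        Matrix.mul_smul]
    · change prodX p (s + 1).1 * _ * _ = _
      rw [val_add_one_of_ne hs, imageData_Y_of_ne _ _ hs, prodX_succ, hXY, Matrix.sub_mul,
        Matrix.mul_assoc, Matrix.mul_nonsing_inv _ (hu _), Matrix.mul_one]
  · funext α
    change p.V α ᵥ* (gauge p h 0)⁻¹.1 = (p.V α ᵥ* (prodX p m)⁻¹) ᵥ* prodX p m
    rw [hz', Matrix.vecMul_vecMul, Matrix.nonsing_inv_mul _ (hu m)]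
  · funext α
    change (gauge p h 0).1 *ᵥ p.W α = (prodX p m)⁻¹ *ᵥ (prodX p m *ᵥ p.W α)
    rw [hz, Matrix.mulVec_mulVec, Matrix.nonsing_inv_mul _ (hu m)]

end Gauge

section Orbits

variable {m n d : ℕ} [NeZero m] {q : Fin m → ℂˣ}

/-- The point of `TadpoleRep` attached to a point of `CyclicRep` with all `X_s` invertible. -/
noncomputable def tadpoleRep (p : CyclicRep n d q) (h : ∀ s, (p.1.X s).det ≠ 0) :
    TadpoleRep n d (totalT q) :=
  ⟨tadpoleData q p.1, isTadpole_tadpoleData h p.2⟩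

theorem orbitRel_imageRep_tadpoleRep (p : CyclicRep n d q)
    (h : ∀ s, (p.1.X s).det ≠ 0) :
    MulAction.orbitRel (Fin m → GL (Fin n) ℂ) _ (imageRep q (tadpoleRep p h)) p :=
  ⟨gauge p.1 h, Subtype.ext (gauge_smul h p.2)⟩

theorem det_X_smul_ne_zero {p : CyclicRep n d q} (g : Fin m → GL (Fin n) ℂ)
    (h : ∀ s, (p.1.X s).det ≠ 0) (s : Fin m) : ((g • p).1.X s).det ≠ 0 := by
  change ((g s).1 * p.1.X s * (g (s + 1))⁻¹.1).det ≠ 0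
  have hdet : ∀ k : GL (Fin n) ℂ, k.1.det ≠ 0 :=
    fun k => ((Matrix.isUnit_iff_isUnit_det _).1 k.isUnit).ne_zero
  rw [Matrix.det_mul, Matrix.det_mul]
  exact mul_ne_zero (mul_ne_zero (hdet _) (h s)) (hdet _)

theorem isUnit_X_iff (p : CyclicRep n d q) :
    (∀ s, IsUnit (p.1.X s)) ↔
      ∃ τ, MulAction.orbitRel (Fin m → GL (Fin n) ℂ) _ p (imageRep q τ) := by
  constructor
  · intro h
    have h' : ∀ s, (p.1.X s).det ≠ 0 :=
      fun s => ((Matrix.isUnit_iff_isUnit_det _).1 (h s)).ne_zero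
    exact ⟨tadpoleRep p h', (MulAction.orbitRel _ _).symm' (orbitRel_imageRep_tadpoleRep p h')⟩
  · rintro ⟨τ, g, rfl⟩ s
    exact (Matrix.isUnit_iff_isUnit_det _).2
      (det_X_smul_ne_zero g (imageData_X_det q τ.2.det_A) s).isUnit

/-- The construction `tadpoleRep` is compatible with the group actions. -/
theorem orbitRel_tadpoleRep_smul (hm : 2 ≤ m) (g : Fin m → GL (Fin n) ℂ) (p : CyclicRep n d q)
    (h : ∀ s, (p.1.X s).det ≠ 0) (h' : ∀ s, ((g • p).1.X s).det ≠ 0) :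
    MulAction.orbitRel (GL (Fin n) ℂ) _ (tadpoleRep (g • p) h') (tadpoleRep p h) := by
  rw [orbitRel_iff q hm]
  exact (MulAction.orbitRel _ _).trans' (orbitRel_imageRep_tadpoleRep _ h')
    ((MulAction.orbitRel _ _).trans' ⟨g, rfl⟩
    ((MulAction.orbitRel _ _).symm' (orbitRel_imageRep_tadpoleRep p h)))

theorem orbitRel_tadpoleRep_imageRep (hm : 2 ≤ m) (τ : TadpoleRep n d (totalT q))
    (h : ∀ s, ((imageRep q τ).1.X s).det ≠ 0) :
    MulAction.orbitRel (GL (Fin n) ℂ) _ (tadpoleRep (imageRep q τ) h) τ := by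
  rw [orbitRel_iff q hm]
  exact orbitRel_imageRep_tadpoleRep _ h

end Orbits

/-! ### Regular matrix-valued functions -/

section Regular

variable {P : Type} {O : Subalgebra ℂ (P → ℂ)} {n : ℕ}

/-- A matrix-valued function is regular if all its entries are. -/
def IsRegularMatrix (O : Subalgebra ℂ (P → ℂ)) (M : P → Matrix (Fin n) (Fin n) ℂ) : Prop :=
  ∀ i j, (fun x => M x i j) ∈ O

/-- A vector-valued function is regular if all its coordinates are. -/
def IsRegularVector (O : Subalgebra ℂ (P → ℂ)) (v : P → Fin n → ℂ) : Prop :=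
  ∀ i, (fun x => v x i) ∈ O

theorem const_mem (c : ℂ) : (fun _ : P => c) ∈ O := O.algebraMap_mem c

theorem sum_fun_mem {ι : Type} (s : Finset ι) {f : ι → P → ℂ} (h : ∀ i ∈ s, f i ∈ O) :
    (fun x => ∑ i ∈ s, f i x) ∈ O := by
  have := Subalgebra.sum_mem O h
  rwa [show ∑ i ∈ s, f i = fun x => ∑ i ∈ s, f i x from
    funext fun x => Finset.sum_apply _ _ _] at this

theorem prod_fun_mem {ι : Type} (s : Finset ι) {f : ι → P → ℂ} (h : ∀ i ∈ s, f i ∈ O) :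
    (fun x => ∏ i ∈ s, f i x) ∈ O := by
  have := Subalgebra.prod_mem O h
  rwa [show ∏ i ∈ s, f i = fun x => ∏ i ∈ s, f i x from
    funext fun x => Finset.prod_apply _ _ _] at this

variable {M N : P → Matrix (Fin n) (Fin n) ℂ} {v w : P → Fin n → ℂ}

theorem IsRegularMatrix.one : IsRegularMatrix O (fun _ => (1 : Matrix (Fin n) (Fin n) ℂ)) :=
  fun _ _ => const_mem _

theorem IsRegularMatrix.add (hM : IsRegularMatrix O M) (hN : IsRegularMatrix O N) :
    IsRegularMatrix O (fun x => M x + N x) :=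
  fun i j => O.add_mem (hM i j) (hN i j)

theorem IsRegularMatrix.sub (hM : IsRegularMatrix O M) (hN : IsRegularMatrix O N) :
    IsRegularMatrix O (fun x => M x - N x) :=
  fun i j => O.sub_mem (hM i j) (hN i j)

theorem IsRegularMatrix.smul (c : P → ℂ) (hc : c ∈ O) (hM : IsRegularMatrix O M) :
    IsRegularMatrix O (fun x => c x • M x) :=
  fun i j => O.mul_mem hc (hM i j)

theorem IsRegularMatrix.mul (hM : IsRegularMatrix O M) (hN : IsRegularMatrix O N) :
    IsRegularMatrix O (fun x => M x * N x) :=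
  fun i j => sum_fun_mem Finset.univ (f := fun k x => M x i k * N x k j)
    fun k _ => O.mul_mem (hM i k) (hN k j)

theorem IsRegularMatrix.det (hM : IsRegularMatrix O M) : (fun x => (M x).det) ∈ O := by
  simp only [Matrix.det_apply']
  exact sum_fun_mem _ fun σ _ => O.mul_mem (const_mem _) (prod_fun_mem _ fun i _ => hM _ _)

theorem IsRegularMatrix.adjugate (hM : IsRegularMatrix O M) :
    IsRegularMatrix O (fun x => (M x).adjugate) := by
  intro i j
  simp only [Matrix.adjugate_apply]
  refine IsRegularMatrix.det (M := fun x => (M x).updateRow j (Pi.single i 1)) fun k l => ?_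
  simp only [Matrix.updateRow_apply]
  split_ifs
  · exact const_mem _
  · exact hM k l

theorem IsRegularMatrix.inv (hM : IsRegularMatrix O M) (hd : (fun x => (M x).det⁻¹) ∈ O) :
    IsRegularMatrix O (fun x => (M x)⁻¹) := by
  simp only [Matrix.inv_def, Ring.inverse_eq_inv']
  exact IsRegularMatrix.smul _ hd hM.adjugate

theorem IsRegularMatrix.vecMul (hv : IsRegularVector O v) (hM : IsRegularMatrix O M) :
    IsRegularVector O (fun x => v x ᵥ* M x) :=
  fun j => sum_fun_mem Finset.univ (f := fun k x => v x k * M x k j)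
    fun k _ => O.mul_mem (hv k) (hM k j)

theorem IsRegularMatrix.mulVec (hM : IsRegularMatrix O M) (hv : IsRegularVector O v) :
    IsRegularVector O (fun x => M x *ᵥ v x) :=
  fun i => sum_fun_mem Finset.univ (f := fun k x => M x i k * v x k)
    fun k _ => O.mul_mem (hM i k) (hv k)

theorem IsRegularMatrix.list_prod (l : List (P → Matrix (Fin n) (Fin n) ℂ))
    (h : ∀ M ∈ l, IsRegularMatrix O M) :
    IsRegularMatrix O (fun x => (l.map fun M => M x).prod) := by
  induction l with
  | nil => exact IsRegularMatrix.one
  | cons M l ih =>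
    simp only [List.map_cons, List.prod_cons]
    exact (h M (by simp)).mul (ih fun N hN => h N (by simp [hN]))

end Regular

/-! ### Regular functions under the two constructions -/

section Functions

variable {m n d : ℕ}

theorem tadpole_A (t : ℂˣ) : IsRegularMatrix (tadpoleFunctions n d t) (fun τ => τ.1.A) :=
  fun i j => Algebra.subset_adjoin
    (Or.inl (Or.inl (Or.inl (Or.inl (Or.inl (Or.inl ⟨i, j, rfl⟩))))))

theorem tadpole_B (t : ℂˣ) : IsRegularMatrix (tadpoleFunctions n d t) (fun τ => τ.1.B) :=
  fun i j => Algebra.subset_adjoin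
    (Or.inl (Or.inl (Or.inl (Or.inl (Or.inl (Or.inr ⟨i, j, rfl⟩))))))

theorem tadpole_V (t : ℂˣ) (α : Fin d) :
    IsRegularVector (tadpoleFunctions n d t) (fun τ => τ.1.V α) :=
  fun i => Algebra.subset_adjoin (Or.inl (Or.inl (Or.inl (Or.inl (Or.inr ⟨α, i, rfl⟩)))))

theorem tadpole_W (t : ℂˣ) (α : Fin d) :
    IsRegularVector (tadpoleFunctions n d t) (fun τ => τ.1.W α) :=
  fun i => Algebra.subset_adjoin (Or.inl (Or.inl (Or.inl (Or.inr ⟨α, i, rfl⟩))))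

theorem tadpole_det_A_inv (t : ℂˣ) : (fun τ => τ.1.A.det⁻¹) ∈ tadpoleFunctions n d t :=
  Algebra.subset_adjoin (Or.inl (Or.inl (Or.inr rfl)))

theorem tadpole_det_B_inv (t : ℂˣ) : (fun τ => τ.1.B.det⁻¹) ∈ tadpoleFunctions n d t :=
  Algebra.subset_adjoin (Or.inl (Or.inr rfl))

theorem tadpole_det_rankOne_inv (t : ℂˣ) (α : Fin d) :
    (fun τ => (rankOne (τ.1.W α) (τ.1.V α)).det⁻¹) ∈ tadpoleFunctions n d t :=
  Algebra.subset_adjoin (Or.inr ⟨α, rfl⟩)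

variable [NeZero m] (q : Fin m → ℂˣ)

theorem cyclic_X (s : Fin m) : IsRegularMatrix (cyclicFunctions n d q) (fun p => p.1.X s) :=
  fun i j => Algebra.subset_adjoin (Or.inl (Or.inl (Or.inl (Or.inl (Or.inl ⟨s, i, j, rfl⟩)))))

theorem cyclic_Y (s : Fin m) : IsRegularMatrix (cyclicFunctions n d q) (fun p => p.1.Y s) :=
  fun i j => Algebra.subset_adjoin (Or.inl (Or.inl (Or.inl (Or.inl (Or.inr ⟨s, i, j, rfl⟩)))))

theorem cyclic_V (α : Fin d) : IsRegularVector (cyclicFunctions n d q) (fun p => p.1.V α) :=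
  fun i => Algebra.subset_adjoin (Or.inl (Or.inl (Or.inl (Or.inr ⟨α, i, rfl⟩))))

theorem cyclic_W (α : Fin d) : IsRegularVector (cyclicFunctions n d q) (fun p => p.1.W α) :=
  fun i => Algebra.subset_adjoin (Or.inl (Or.inl (Or.inr ⟨α, i, rfl⟩)))

theorem cyclic_det_XY_inv (s : Fin m) :
    (fun p => (1 + p.1.X s * p.1.Y s).det⁻¹) ∈ cyclicFunctions n d q :=
  Algebra.subset_adjoin (Or.inl (Or.inr ⟨s, rfl⟩))

theorem cyclic_VW_inv (α : Fin d) :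
    (fun p => (1 + p.1.V α ⬝ᵥ p.1.W α)⁻¹) ∈ cyclicFunctions n d q :=
  Algebra.subset_adjoin (Or.inr ⟨α, rfl⟩)

theorem cyclic_prodX :
    IsRegularMatrix (cyclicFunctions n d q) (fun p => prodX p.1 m) := by
  have h := IsRegularMatrix.list_prod
    (List.ofFn fun s => fun p : CyclicRep n d q => p.1.X s) (O := cyclicFunctions n d q)
    (fun M hM => by
      obtain ⟨s, rfl⟩ := List.mem_ofFn.1 hM
      exact cyclic_X q s)
  simp only [List.map_ofFn] at h
  simp only [prodX_self]
  exact h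

theorem detX_apply (p : CyclicRep n d q) : (detX n d q).1 p = ∏ s, (p.1.X s).det := rfl

theorem detX_ne_zero_iff (p : CyclicRep n d q) :
    (detX n d q).1 p ≠ 0 ↔ ∀ s, (p.1.X s).det ≠ 0 := by
  rw [detX_apply, Finset.prod_ne_zero_iff]
  simp

theorem detX_imageRep (τ : TadpoleRep n d (totalT q)) :
    (detX n d q).1 (imageRep q τ) = τ.1.A.det := by
  rw [detX_apply, Finset.prod_eq_single (-1)]
  · exact congrArg Matrix.det (imageData_X_last q τ.1)
  · intro s _ hs
    rw [← Matrix.det_one (n := Fin n) (R := ℂ)]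
    exact congrArg Matrix.det (imageData_X_of_ne q τ.1 hs)
  · simp

/-- The map `imageRep` is a morphism of varieties. -/
theorem comp_imageRep_mem {f : CyclicRep n d q → ℂ} (hf : f ∈ cyclicFunctions n d q) :
    (fun τ => f (imageRep q τ)) ∈ tadpoleFunctions n d (totalT q) := by
  have hAinv := (tadpole_A (n := n) (d := d) (totalT q)).inv (tadpole_det_A_inv _)
  induction hf using Algebra.adjoin_induction with
  | mem f hf =>
    rcases hf with ((((⟨s, i, j, rfl⟩ | ⟨s, i, j, rfl⟩) | ⟨α, i, rfl⟩) | ⟨α, i, rfl⟩) |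
      ⟨s, rfl⟩) | ⟨α, rfl⟩
    · by_cases hs : s = -1
      · subst hs
        simpa only [imageRep, imageData_X_last] using tadpole_A (totalT q) i j
      · simpa only [imageRep, imageData_X_of_ne q _ hs] using const_mem _
    · by_cases hs : s = -1
      · subst hs
        simp only [imageRep, imageData_Y_last]
        exact ((hAinv.mul (tadpole_B _)).smul _ (const_mem _)).sub hAinv i j
      · simp only [imageRep, imageData_Y_of_ne q _ hs]
        exact ((tadpole_B _).smul _ (const_mem _)).sub IsRegularMatrix.one i j
    · exact IsRegularMatrix.vecMul (tadpole_V _ α) (tadpole_A _) i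
    · exact IsRegularMatrix.mulVec hAinv (tadpole_W _ α) i
    · have h : (fun τ : TadpoleRep n d (totalT q) =>
          (1 + (imageRep q τ).1.X s * (imageRep q τ).1.Y s).det⁻¹) =
          fun τ => (((partialT q s : ℂ) ^ n)⁻¹) * τ.1.B.det⁻¹ := by
        funext τ
        rw [imageRep, imageData_XY q τ.2.det_A, Matrix.det_smul, Fintype.card_fin, mul_inv]
      rw [h]
      exact Subalgebra.mul_mem _ (const_mem _) (tadpole_det_B_inv _)
    · have h : (fun τ : TadpoleRep n d (totalT q) =>
          (1 + (imageRep q τ).1.V α ⬝ᵥ (imageRep q τ).1.W α)⁻¹) =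
          fun τ => (rankOne (τ.1.W α) (τ.1.V α)).det⁻¹ := by
        funext τ
        rw [← det_rankOne, imageRep, rankOne_imageData q τ.2.det_A, det_inv_conj τ.2.det_A]
      rw [h]
      exact tadpole_det_rankOne_inv _ α
  | algebraMap r => exact const_mem r
  | add f g _ _ hf hg => exact Subalgebra.add_mem _ hf hg
  | mul f g _ _ hf hg => exact Subalgebra.mul_mem _ hf hg

/-- The map `tadpoleRep` is a morphism of varieties on the locus where `∏ det X_s ≠ 0`: the
pullback of a regular function is regular up to a power of the denominator `∏ det X_s`. -/
theorem exists_tadpoleRep_mul_pow {F : TadpoleRep n d (totalT q) → ℂ}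
    (hF : F ∈ tadpoleFunctions n d (totalT q)) :
    ∃ k : ℕ, ∃ H ∈ cyclicFunctions n d q, ∀ (p : CyclicRep n d q) (h : ∀ s, (p.1.X s).det ≠ 0),
      F (tadpoleRep p h) * (detX n d q).1 p ^ k = H p := by
  have hdetX := (detX n d q).2.1
  have hdet : ∀ p : CyclicRep n d q, (prodX p.1 m).det = (detX n d q).1 p :=
    fun p => det_prodX_self p.1
  induction hF using Algebra.adjoin_induction with
  | mem F hF =>
    rcases hF with (((((⟨i, j, rfl⟩ | ⟨i, j, rfl⟩) | ⟨α, i, rfl⟩) | ⟨α, i, rfl⟩) | rfl) |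
      rfl) | ⟨α, rfl⟩
    · exact ⟨0, _, cyclic_prodX q i j, fun p h => by rw [pow_zero, mul_one]; rfl⟩
    · refine ⟨0, _, ((IsRegularMatrix.one.add ((cyclic_X q 0).mul (cyclic_Y q 0))).smul
        (fun _ => (((q 0)⁻¹ : ℂˣ) : ℂ)) (const_mem _)) i j,
        fun p h => by rw [pow_zero, mul_one]; rfl⟩
    -- `A⁻¹ = (det A)⁻¹ adj A`, where `det A = ∏ det X_s`.
    · refine ⟨1, _, IsRegularMatrix.vecMul (cyclic_V q α) (cyclic_prodX q).adjugate i,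
        fun p h => ?_⟩
      have hne := (detX_ne_zero_iff q p).2 h
      change (p.1.V α ᵥ* (prodX p.1 m)⁻¹) i * _ = _
      rw [Matrix.inv_def, Ring.inverse_eq_inv', hdet, Matrix.vecMul_smul, Pi.smul_apply,
        smul_eq_mul, pow_one, mul_right_comm, inv_mul_cancel₀ hne, one_mul]
    · exact ⟨0, _, IsRegularMatrix.mulVec (cyclic_prodX q) (cyclic_W q α) i,
        fun p h => by rw [pow_zero, mul_one]; rfl⟩
    · refine ⟨1, _, const_mem 1, fun p h => ?_⟩
      have hne := (detX_ne_zero_iff q p).2 h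
      change (prodX p.1 m).det⁻¹ * _ = _
      rw [hdet, pow_one, inv_mul_cancel₀ hne]
    · refine ⟨0, _, Subalgebra.mul_mem _ (const_mem (((((q 0)⁻¹ : ℂˣ) : ℂ) ^ n)⁻¹))
        (cyclic_det_XY_inv q 0), fun p h => ?_⟩
      change ((((q 0)⁻¹ : ℂˣ) : ℂ) • (1 + p.1.X 0 * p.1.Y 0)).det⁻¹ * _ = _
      rw [Matrix.det_smul, Fintype.card_fin, mul_inv, pow_zero, mul_one]
      rfl
    · refine ⟨0, _, cyclic_VW_inv q α, fun p h => ?_⟩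
      change (rankOne ((tadpoleData q p.1).W α) ((tadpoleData q p.1).V α)).det⁻¹ * _ = _
      rw [det_rankOne_tadpoleData h, det_rankOne, pow_zero, mul_one]
  | algebraMap r => exact ⟨0, _, const_mem r, fun p h => by rw [pow_zero, mul_one]; rfl⟩
  | add F F' _ _ hF hF' =>
    obtain ⟨k, H, hH, e⟩ := hF
    obtain ⟨k', H', hH', e'⟩ := hF'
    refine ⟨k + k', _, Subalgebra.add_mem _
      (Subalgebra.mul_mem _ hH (Subalgebra.pow_mem _ hdetX k'))
      (Subalgebra.mul_mem _ hH' (Subalgebra.pow_mem _ hdetX k)), fun p h => ?_⟩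
    simp only [Pi.add_apply, Pi.mul_apply, Pi.pow_apply, ← e p h, ← e' p h]
    ring
  | mul F F' _ _ hF hF' =>
    obtain ⟨k, H, hH, e⟩ := hF
    obtain ⟨k', H', hH', e'⟩ := hF'
    refine ⟨k + k', _, Subalgebra.mul_mem _ hH hH', fun p h => ?_⟩
    simp only [Pi.mul_apply, ← e p h, ← e' p h]
    ring

end Functions

/-! ### The isomorphism of quotients -/

/-- A ring homomorphism with the universal properties of the localization away from `f` identifies
the spectrum of its target with the basic open subset defined by `f`. -/
theorem exists_iso_basicOpen {R S : Type} [CommRing R] [CommRing S] (φ : R →+* S) (f : R)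
    (hunit : IsUnit (φ f)) (hsurj : ∀ z, ∃ (k : ℕ) (x : R), z * φ f ^ k = φ x)
    (hinj : ∀ x y, φ x = φ y → ∃ k : ℕ, f ^ k * x = f ^ k * y) :
    ∃ e : Spec (CommRingCat.of S) ≅ Scheme.Opens.toScheme (X := Spec (CommRingCat.of R))
        (PrimeSpectrum.basicOpen f),
      e.hom ≫ Scheme.Opens.ι (X := Spec (CommRingCat.of R)) (PrimeSpectrum.basicOpen f) =
        Spec.map (CommRingCat.ofHom φ) := by
  let _ := φ.toAlgebra
  have : IsLocalization (Submonoid.powers f) S := by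
    rw [isLocalization_iff]
    refine ⟨?_, fun z => ?_, fun {x y} hxy => ?_⟩
    · rintro ⟨_, k, rfl⟩
      change IsUnit (φ (f ^ k))
      rw [map_pow]; exact hunit.pow k
    · obtain ⟨k, x, h⟩ := hsurj z
      refine ⟨⟨x, ⟨f ^ k, k, rfl⟩⟩, ?_⟩
      change z * φ (f ^ k) = φ x
      rw [map_pow, h]
    · obtain ⟨k, h⟩ := hinj x y hxy
      exact ⟨⟨f ^ k, k, rfl⟩, h⟩
  let ε := IsLocalization.algEquiv (Submonoid.powers f) (Localization.Away f) S
  let e₁ : Spec (CommRingCat.of S) ≅ Spec (CommRingCat.of (Localization.Away f)) :=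
    Scheme.Spec.mapIso ε.toRingEquiv.toCommRingCatIso.op
  refine ⟨e₁ ≪≫ (basicOpenIsoSpecAway (R := CommRingCat.of R) f).symm, ?_⟩
  rw [Iso.trans_hom, Iso.symm_hom, Category.assoc]
  have h1 : (basicOpenIsoSpecAway (R := CommRingCat.of R) f).inv ≫
      Scheme.Opens.ι (X := Spec (CommRingCat.of R)) (PrimeSpectrum.basicOpen f) =
      Spec.map (CommRingCat.ofHom (algebraMap R (Localization.Away f))) := by
    rw [Iso.inv_comp_eq]; exact (basicOpenIsoSpecAway_hom_SpecMap _).symm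
  rw [h1]
  change Spec.map (CommRingCat.ofHom (ε : Localization.Away f →+* S)) ≫ _ = _
  rw [← Spec.map_comp, ← CommRingCat.ofHom_comp]
  congr 2
  exact RingHom.ext fun x => ε.commutes x

section Quotients

variable {m : ℕ} [NeZero m] (q : Fin m → ℂˣ)

theorem eq_of_orbitRel {G P : Type} [Group G] [MulAction G P] {O : Subalgebra ℂ (P → ℂ)}
    (f : invariants G O) {x y : P} (h : MulAction.orbitRel G P x y) : f.1 x = f.1 y := by
  obtain ⟨g, rfl⟩ := h
  exact f.2.2 g y

/-- Pullback of invariant functions along `imageRep`. -/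
noncomputable def pullback (n d : ℕ) :
    invariants (Fin m → GL (Fin n) ℂ) (cyclicFunctions n d q) →ₐ[ℂ]
      invariants (GL (Fin n) ℂ) (tadpoleFunctions n d (totalT q)) where
  toFun f := ⟨fun τ => f.1 (imageRep q τ), comp_imageRep_mem q f.2.1,
    fun g τ => (congrArg f.1 (imageRep_smul q g τ)).trans (f.2.2 _ _)⟩
  map_one' := rfl
  map_mul' _ _ := rfl
  map_zero' := rfl
  map_add' _ _ := rfl
  commutes' _ := rfl

variable {n d : ℕ}

theorem isUnit_pullback_detX : IsUnit (pullback q n d (detX n d q)) := by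
  have hdet : ∀ (g : GL (Fin n) ℂ) (τ : TadpoleRep n d (totalT q)),
      (g • τ).1.A.det⁻¹ = τ.1.A.det⁻¹ := fun g τ => congrArg (·⁻¹) (conj_det g τ.1.A)
  refine IsUnit.of_mul_eq_one (⟨fun τ => τ.1.A.det⁻¹, tadpole_det_A_inv _, hdet⟩ :
    invariants (GL (Fin n) ℂ) (tadpoleFunctions n d (totalT q))) (Subtype.ext (funext fun τ => ?_))
  change (detX n d q).1 (imageRep q τ) * τ.1.A.det⁻¹ = 1
  rw [detX_imageRep, mul_inv_cancel₀ τ.2.det_A]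

theorem exists_mul_pow_eq_pullback (hm : 2 ≤ m)
    (F : invariants (GL (Fin n) ℂ) (tadpoleFunctions n d (totalT q))) :
    ∃ (k : ℕ) (f : invariants (Fin m → GL (Fin n) ℂ) (cyclicFunctions n d q)),
      F * pullback q n d (detX n d q) ^ k = pullback q n d f := by
  obtain ⟨k, H, hH, e⟩ := exists_tadpoleRep_mul_pow q F.2.1
  -- The extra factor `∏ det X_s` forces the extension of `F ∘ tadpoleRep` to vanish where
  -- `∏ det X_s = 0`, so that it is invariant on all of `CyclicRep`.
  have hinv : ∀ (g : Fin m → GL (Fin n) ℂ) (p : CyclicRep n d q),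
      (H * (detX n d q).1) (g • p) = (H * (detX n d q).1) p := by
    intro g p
    have hd : (detX n d q).1 (g • p) = (detX n d q).1 p := (detX n d q).2.2 g p
    simp only [Pi.mul_apply, hd]
    by_cases h0 : (detX n d q).1 p = 0
    · rw [h0, mul_zero, mul_zero]
    · have h := (detX_ne_zero_iff q p).1 h0
      have h' := det_X_smul_ne_zero g h
      rw [← e p h, ← e (g • p) h', hd, eq_of_orbitRel F (orbitRel_tadpoleRep_smul hm g p h h')]
  refine ⟨k + 1, ⟨H * (detX n d q).1, Subalgebra.mul_mem _ hH (detX n d q).2.1, hinv⟩,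
    Subtype.ext (funext fun τ => ?_)⟩
  change F.1 τ * (detX n d q).1 (imageRep q τ) ^ (k + 1) =
    H (imageRep q τ) * (detX n d q).1 (imageRep q τ)
  have h := imageData_X_det q τ.2.det_A
  rw [← e (imageRep q τ) h, eq_of_orbitRel F (orbitRel_tadpoleRep_imageRep hm τ h), pow_succ,
    mul_assoc]

theorem detX_mul_eq_of_pullback_eq
    (f f' : invariants (Fin m → GL (Fin n) ℂ) (cyclicFunctions n d q))
    (h : pullback q n d f = pullback q n d f') : detX n d q * f = detX n d q * f' := by
  refine Subtype.ext (funext fun p => ?_)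
  change (detX n d q).1 p * f.1 p = (detX n d q).1 p * f'.1 p
  by_cases h0 : (detX n d q).1 p = 0
  · rw [h0, zero_mul, zero_mul]
  · have hX := (detX_ne_zero_iff q p).1 h0
    have h1 := orbitRel_imageRep_tadpoleRep p hX
    rw [← eq_of_orbitRel f h1, ← eq_of_orbitRel f' h1]
    exact congrArg _ (congrFun (congrArg Subtype.val h) (tadpoleRep p hX))

theorem exists_iso_cyclicOpen (hm : 2 ≤ m) :
    ∃ e : tadpoleSpace n d (totalT q) ≅ (cyclicOpen n d q).toScheme,
      e.hom ≫ (cyclicOpen n d q).ι = Spec.map (CommRingCat.ofHom (pullback q n d).toRingHom) :=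
  exists_iso_basicOpen (pullback q n d).toRingHom (detX n d q) (isUnit_pullback_detX q)
    (exists_mul_pow_eq_pullback q hm)
    (fun f f' h => ⟨1, by rw [pow_one]; exact detX_mul_eq_of_pullback_eq q f f' h⟩)

end Quotients

end SpinRS

open SpinRS in
theorem proposition5p2 (m n d : ℕ) [NeZero m] (hm : 2 ≤ m) (hn : 1 ≤ n) (hd : 2 ≤ d)
    (q : Fin m → ℂˣ) (hq : RegularParameters q) :
    ∃ ψ : TadpoleRep n d (totalT q) → CyclicRep n d q,
      (∀ τ p, IsImage τ p ↔ p = ψ τ) ∧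
      (∀ τ τ', MulAction.orbitRel (GL (Fin n) ℂ) _ τ τ' ↔
        MulAction.orbitRel (Fin m → GL (Fin n) ℂ) _ (ψ τ) (ψ τ')) ∧
      (∀ p : CyclicRep n d q, (∀ s, IsUnit (p.1.X s)) ↔
        ∃ τ, MulAction.orbitRel (Fin m → GL (Fin n) ℂ) _ p (ψ τ)) ∧
      ∃ e : tadpoleSpace n d (totalT q) ≅ (cyclicOpen n d q).toScheme,
        e.hom ≫ (cyclicOpen n d q).ι ≫ cyclicStr n d q = tadpoleStr n d (totalT q) ∧
        ∀ τ, tadpolePoint τ ≫ e.hom ≫ (cyclicOpen n d q).ι = cyclicPoint (ψ τ) := by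
  obtain ⟨e, he⟩ := exists_iso_cyclicOpen (n := n) (d := d) q hm
  refine ⟨imageRep q, isImage_iff q, orbitRel_iff q hm, isUnit_X_iff, e, ?_, fun τ => ?_⟩
  · rw [← Category.assoc, he]
    refine (Spec.map_comp _ _).symm.trans ?_
    rw [← CommRingCat.ofHom_comp]
    exact congrArg (fun φ => Spec.map (CommRingCat.ofHom φ)) (pullback q n d).comp_algebraMap
  · rw [he]
    exact (Spec.map_comp _ _).symm
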